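/- **Setting.** Let $\phi_A:\mathcal A\to\mathcal H_A$, $\phi_B:\mathcal B\to\mathcal H_B$, $\phi_C:\mathcal C\to\mathcal H_C$ be (strongly) measurable feature maps into real Hilbert spaces, and let $\hat\mu_{A|C}:\mathcal C\to\mathcal H_A$, $\hat\mu_{B|C}:\mathcal C\to\mathcal H_B$ be fixed (strongly) measurable maps (the estimated conditional mean embeddings). For $x=(a,b,c)$, $x'=(a',b',c')$ put $$\hat h(x,x')=\langle\phi_C(c),\phi_C(c')\rangle\,\langle\phi_A(a)-\hat\mu_{A|C}(c),\,\phi_A(a')-\hat\mu_{A|C}(c')\rangle\,\langle\phi_B(b)-\hat\mu_{B|C}(c),\,\phi_B(b')-\hat\mu_{B|C}(c')\rangle .$$ Let $P$ be the law of $(A,B,C)$, assume the null hypothesis that $A$ and $B$ are conditionally independent given $C$ (that is, $E[f(A,C)g(B,C)\mid C]=E[f(A,C)\mid C]\,E[g(B,C)\mid C]$ a.s. for all square-integrable $f(A,C)$, $g(B,C)$), and assume $\hat h\in L^2(P\otimes P)$. Let $X_1,\dots,X_n$ be i.i.d. with law $P$, put $\hat h_{ij}=\hat h(X_i,X_j)$,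 $$\widehat{\mathrm{KCI}}_n=\frac1{n(n-1)}\sum_{i\ne j}\hat h_{ij},\qquad \widehat{\mathrm{KCI}}=\int\!\!\int \hat h\,dP\,dP,$$ assume $\mathrm{Var}(\widehat{\mathrm{KCI}}_n)>0$, and let $Z_n\sim\mathcal N(\widehat{\mathrm{KCI}},\mathrm{Var}(\widehat{\mathrm{KCI}}_n))$. Let $\varepsilon_1,\dots,\varepsilon_n$ be i.i.d. $\mathcal N(0,1)$, independent of $(X_1,\dots,X_n)$. For a real $n\times n$ matrix $M$ with singular values $\sigma_1,\dots,\sigma_n$ write $\|M\|_p=(\sum_r\sigma_r^p)^{1/p}$ for $p<\infty$ and $\|M\|_\infty=\max_r\sigma_r$ (Schatten norms). Consider either of the two conventions for the wild bootstrap variable $Y$ and its matrix $\hat H$: (i) $\hat H=(\hat h_{ij})_{i,j}$ is the full kernel matrix and $Y=\frac1n\sum_{i,j=1}^n\hat h_{ij}\,(\varepsilon_i\varepsilon_j-\mathbf 1\{i=j\})$, the quadratic form $\frac1n\sum_{i,j}\hat h_{ij}\varepsilon_i\varepsilon_j$ centered at its conditional mean $\frac1n\mathrm{tr}\,\hat H$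 given $\hat H$; (ii) $\hat H$ has entries $\hat h_{ij}$ for $i\ne j$ and zero diagonal, and $Y=\frac1n\sum_{i\ne j}\hat h_{ij}\,\varepsilon_i\varepsilon_j$. Where $\hat H\ne0$, put $$\delta=\frac{\|\hat H\|_\infty^2}{\|\hat H\|_2^2},\quad b=\frac{\widehat{\mathrm{KCI}}}{\sqrt{\mathrm{Var}(\widehat{\mathrm{KCI}}_n)}},\quad k=\frac{\mathrm{Var}(Y\mid\hat H)}{n^2\,\mathrm{Var}(\widehat{\mathrm{KCI}}_n)},$$ $$R_1=\tfrac43\sqrt2\,\pi^2\,\frac{\|\hat H\|_3^3}{\|\hat H\|_2^3},\quad R_2=\frac{2^{-5/4}\pi^{-2}}{\sqrt{1-2\delta}},\quad R_3=(2\pi)^{-7/2},\quad \Psi(x)=\frac1{\sqrt{2\pi}}\,x\,e^{2\pi x}.$$ **Theorem.** In both conventions, almost surely, if $\hat H\ne0$ and $\delta<1/2$, then $$\sup_{x\in\mathbb R}\bigl|\Pr(Y\le x\mid\hat H)-\Pr(nZ_n\le x)\bigr|\;\le\;\Psi\bigl(R_1k^{3/2}+b+\pi|k-1|\bigr)+R_2\,k^{-1/2}+R_3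 .$$ In convention (i), moreover, $R_1=\frac{2\pi^2}{3}\,\mathrm{Skew}(Y\mid\hat H)$, the conditional skewness. -/

import Mathlib

open MeasureTheory ProbabilityTheory

noncomputable section

namespace KCI

/-- Conditional independence of the coordinates `A` and `B` given the coordinate `C` under the
joint law `P` of `(A, B, C)`: conditional expectations of products of square-integrable functions
of `(A, C)` and of `(B, C)` factorize. -/
def CondIndepGiven {𝒜 ℬ 𝒞 : Type*} [MeasurableSpace 𝒜] [MeasurableSpace ℬ] [MeasurableSpace 𝒞]
    (P : Measure (𝒜 × ℬ × 𝒞)) : Prop :=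
  ∀ (f : 𝒜 × 𝒞 → ℝ) (g : ℬ × 𝒞 → ℝ), Measurable f → Measurable g →
    MemLp (fun x : 𝒜 × ℬ × 𝒞 => f (x.1, x.2.2)) 2 P →
    MemLp (fun x : 𝒜 × ℬ × 𝒞 => g (x.2.1, x.2.2)) 2 P →
    P[fun x => f (x.1, x.2.2) * g (x.2.1, x.2.2) |
        MeasurableSpace.comap (fun x : 𝒜 × ℬ × 𝒞 => x.2.2) inferInstance]
      =ᵐ[P] fun x =>
        (P[fun x => f (x.1, x.2.2) |
          MeasurableSpace.comap (fun x : 𝒜 × ℬ × 𝒞 => x.2.2) inferInstance]) x *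
        (P[fun x => g (x.2.1, x.2.2) |
          MeasurableSpace.comap (fun x : 𝒜 × ℬ × 𝒞 => x.2.2) inferInstance]) x

/-- The kernel `ĥ(x, x') = k_C(c, c') ⟪φ_A(a) - μ̂_A(c), φ_A(a') - μ̂_A(c')⟫
⟪φ_B(b) - μ̂_B(c), φ_B(b') - μ̂_B(c')⟫` at `x = (a, b, c)`, `x' = (a', b', c')`, where
`k_C(c, c') = ⟪φ_C(c), φ_C(c')⟫`. -/
def hHat {𝒜 ℬ 𝒞 HA HB HC : Type*}
    [NormedAddCommGroup HA] [InnerProductSpace ℝ HA]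
    [NormedAddCommGroup HB] [InnerProductSpace ℝ HB]
    [NormedAddCommGroup HC] [InnerProductSpace ℝ HC]
    (φA : 𝒜 → HA) (φB : ℬ → HB) (φC : 𝒞 → HC) (muA : 𝒞 → HA) (muB : 𝒞 → HB)
    (x x' : 𝒜 × ℬ × 𝒞) : ℝ :=
  inner ℝ (φC x.2.2) (φC x'.2.2)
    * inner ℝ (φA x.1 - muA x.2.2) (φA x'.1 - muA x'.2.2)
    * inner ℝ (φB x.2.1 - muB x.2.2) (φB x'.2.1 - muB x'.2.2)

/-- The U-statistic `1 / (n (n - 1)) * ∑_{i ≠ j} h (x i) (x j)`. -/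
def uStat {𝒳 : Type*} (h : 𝒳 → 𝒳 → ℝ) {n : ℕ} (x : Fin n → 𝒳) : ℝ :=
  1 / ((n : ℝ) * ((n : ℝ) - 1)) * ∑ i, ∑ j, if i ≠ j then h (x i) (x j) else 0

/-- The population value `E[h(X, X')]` for independent `X, X' ∼ P`. -/
def population {𝒳 : Type*} [MeasurableSpace 𝒳] (h : 𝒳 → 𝒳 → ℝ) (P : Measure 𝒳) : ℝ :=
  ∫ z, h z.1 z.2 ∂(P.prod P)

/-- The matrix with entries `h (x i) (x j)`. -/
def gram {𝒳 : Type*} (h : 𝒳 → 𝒳 → ℝ) {n : ℕ} (x : Fin n → 𝒳) : Matrix (Fin n) (Fin n) ℝ :=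
  Matrix.of fun i j => h (x i) (x j)

/-- The matrix with entries `h (x i) (x j)` off the diagonal and `0` on the diagonal. -/
def gramOff {𝒳 : Type*} (h : 𝒳 → 𝒳 → ℝ) {n : ℕ} (x : Fin n → 𝒳) :
    Matrix (Fin n) (Fin n) ℝ :=
  Matrix.of fun i j => if i ≠ j then h (x i) (x j) else 0

/-- The wild bootstrap variable `1 / n * ∑_{i, j} M i j * (e i * e j - 1{i = j})`, that is, the
quadratic form centered at its mean under i.i.d. standard Gaussian `e`. -/
def wildBootstrap {n : ℕ} (M : Matrix (Fin n) (Fin n) ℝ) (e : Fin n → ℝ) : ℝ :=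
  1 / (n : ℝ) * ∑ i, ∑ j, M i j * (e i * e j - if i = j then 1 else 0)

/-- The wild bootstrap variable without diagonal terms, `1 / n * ∑_{i ≠ j} M i j * e i * e j`. -/
def wildBootstrapOff {n : ℕ} (M : Matrix (Fin n) (Fin n) ℝ) (e : Fin n → ℝ) : ℝ :=
  1 / (n : ℝ) * ∑ i, ∑ j, if i ≠ j then M i j * e i * e j else 0

/-- The conditional law of the random variable `Y` given the random matrix `H`, at the value
`H ω` of the matrix. -/
def condLaw {Ω : Type*} [MeasurableSpace Ω] {n : ℕ} (Y : Ω → ℝ)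
    (H : Ω → Matrix (Fin n) (Fin n) ℝ) (ρ : Measure Ω) [IsFiniteMeasure ρ] (ω : Ω) : Measure ℝ :=
  condDistrib Y (fun (ω' : Ω) (i j : Fin n) => H ω' i j) ρ (fun i j => H ω i j)

/-- The singular values of a real square matrix. -/
def singVal {n : ℕ} (M : Matrix (Fin n) (Fin n) ℝ) (r : Fin n) : ℝ :=
  √((Matrix.isHermitian_conjTranspose_mul_self M).eigenvalues r)

/-- The Schatten `p`-norm, for `1 ≤ p < ∞`. -/
def schatten {n : ℕ} (p : ℝ) (M : Matrix (Fin n) (Fin n) ℝ) : ℝ :=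
  (∑ r, singVal M r ^ p) ^ (1 / p)

/-- The Schatten `∞`-norm: the largest singular value. -/
def schattenTop {n : ℕ} (M : Matrix (Fin n) (Fin n) ℝ) : ℝ :=
  ⨆ r, singVal M r

/-- `δ = ‖M‖_∞² / ‖M‖_2²`. -/
def delta {n : ℕ} (M : Matrix (Fin n) (Fin n) ℝ) : ℝ :=
  schattenTop M ^ 2 / schatten 2 M ^ 2

/-- The skewness of a probability law on the real line. -/
def skewness (μ : Measure ℝ) : ℝ :=
  (∫ y, (y - ∫ z, z ∂μ) ^ 3 ∂μ) / Var[id; μ] ^ (3 / 2 : ℝ)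

/-- The Kolmogorov distance of two laws on the real line. -/
def kolmogorovDist (μ ν : Measure ℝ) : ℝ :=
  ⨆ x : ℝ, |μ.real (Set.Iic x) - ν.real (Set.Iic x)|

/-- The standardized mean shift, from the mean `m` and the variance `v` of the statistic. -/
def meanShift (m v : ℝ) : ℝ := m / √v

/-- The variance mismatch, from the conditional law `μ` of the wild bootstrap variable and the
variance `v` of the statistic. -/
def varMismatch (n : ℕ) (μ : Measure ℝ) (v : ℝ) : ℝ := Var[id; μ] / ((n : ℝ) ^ 2 * v)

def R₁ {n : ℕ} (M : Matrix (Fin n) (Fin n) ℝ) : ℝ :=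
  4 / 3 * √2 * Real.pi ^ 2 * schatten 3 M ^ 3 / schatten 2 M ^ 3

def R₂ (δ : ℝ) : ℝ := (2 : ℝ) ^ (-(5 / 4) : ℝ) * Real.pi ^ (-2 : ℝ) / √(1 - 2 * δ)

def R₃ : ℝ := (2 * Real.pi) ^ (-(7 / 2) : ℝ)

def Psi (x : ℝ) : ℝ := 1 / √(2 * Real.pi) * x * Real.exp (2 * Real.pi * x)

end KCI

end

/-!
Conditionally on the sample the kernel matrix is frozen, because the multipliers are independent of
it, and diagonalising the Gaussian quadratic form turns the law of the wild bootstrap variable into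
that of a weighted sum of centred `χ²₁` variables, the weights being the eigenvalues divided by `n`.
So the claim is a Berry–Esseen type bound for such a sum against a normal law. After rescaling the
normal variance to `1`, Fourier inversion writes the difference of the two distribution functions as
an integral of the difference of characteristic functions against `1 / s`. For `|s| ≤ 2π` that
difference is controlled by a third-order expansion of the logarithm of the characteristic function,
which gives the term `Ψ`. For `|s| > 2π` the two characteristic functions are bounded separately:
the `χ²` factors still decay because `δ < 1/2` keeps any single weight from dominating, which gives
`R₂`, and the Gaussian tail gives `R₃`. The mean shift enters with a plus sign because `ĥ` is a
positive definite kernel and hence has nonnegative mean.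
-/

namespace KCI

open Filter Topology Set
open Complex (I)
open scoped FourierTransform Real

noncomputable section

section FourierInversion

/-- The function `x ↦ 1{y ≤ x} - 1{0 ≤ x}`. Subtracting the step at `0` makes the distribution
function of the point mass at `y`, and by averaging that of any law with finite mean, integrable. -/
def stepSub (y x : ℝ) : ℂ := (Ico y 0).indicator 1 x - (Ico 0 y).indicator 1 x

lemma stepSub_eq (y x : ℝ) : stepSub y x = (Iic x).indicator 1 y - (Ici 0).indicator 1 x := by
  simp only [stepSub, indicator, mem_Ico, mem_Iic, mem_Ici, Pi.one_apply]
  grind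

lemma norm_stepSub (y x : ℝ) :
    ‖stepSub y x‖ = (Ico y 0).indicator 1 x + (Ico 0 y).indicator 1 x := by
  simp only [stepSub, indicator, mem_Ico, Pi.one_apply]
  split_ifs <;> first | linarith | simp

lemma measurable_stepSub : Measurable (Function.uncurry stepSub) := by
  have h : MeasurableSet {p : ℝ × ℝ | p.1 ≤ p.2} := measurableSet_le measurable_fst measurable_snd
  have h0 : MeasurableSet {p : ℝ × ℝ | 0 ≤ p.2} := measurableSet_le measurable_const measurable_snd
  have heq : Function.uncurry stepSub =
      fun p => {p : ℝ × ℝ | p.1 ≤ p.2}.indicator 1 p - {p : ℝ × ℝ | 0 ≤ p.2}.indicator 1 p := by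
    ext p
    simp [Function.uncurry, stepSub_eq, indicator]
  rw [heq]
  exact (measurable_one.indicator h).sub (measurable_one.indicator h0)

lemma integrable_stepSub (y : ℝ) : Integrable (stepSub y) := by
  refine Integrable.sub ?_ ?_ <;>
  exact (integrable_indicator_iff measurableSet_Ico).2 (integrableOn_const (by simp))

lemma integral_norm_stepSub (y : ℝ) : ∫ x, ‖stepSub y x‖ = |y| := by
  have hint (a b : ℝ) : Integrable ((Ico a b).indicator (1 : ℝ → ℝ)) :=
    (integrable_indicator_iff measurableSet_Ico).2 (integrableOn_const (by simp))
  simp only [norm_stepSub]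
  rw [integral_add (hint _ _) (hint _ _), integral_indicator_one measurableSet_Ico,
    integral_indicator_one measurableSet_Ico]
  simp [add_comm, max_zero_add_max_neg_zero_eq_abs_self]

lemma integral_mul_stepSub {g : ℝ → ℂ} (hg : Continuous g) (y : ℝ) :
    ∫ x, g x * stepSub y x = ∫ x in y..0, g x := by
  have hint (a b : ℝ) : Integrable ((Ico a b).indicator g) :=
    (integrable_indicator_iff measurableSet_Ico).2
      (hg.integrableOn_Icc.mono_set Ico_subset_Icc_self)
  have hsplit (x : ℝ) : g x * stepSub y x = (Ico y 0).indicator g x - (Ico 0 y).indicator g x := by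
    simp [stepSub, mul_sub, indicator]
  simp only [hsplit]
  rw [integral_sub (hint _ _) (hint _ _), integral_indicator measurableSet_Ico,
    integral_indicator measurableSet_Ico, integral_Ico_eq_integral_Ioc,
    integral_Ico_eq_integral_Ioc, intervalIntegral]

lemma integrable_uncurry_stepSub {μ : Measure ℝ} [SFinite μ] (hμ : Integrable id μ) :
    Integrable (Function.uncurry stepSub) (μ.prod volume) := by
  rw [integrable_prod_iff measurable_stepSub.aestronglyMeasurable]
  refine ⟨.of_forall integrable_stepSub, ?_⟩
  simp only [Function.uncurry_apply_pair, integral_norm_stepSub]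
  exact hμ.abs

variable {μ ν : Measure ℝ} [IsProbabilityMeasure μ] [IsProbabilityMeasure ν]

lemma integral_stepSub (x : ℝ) :
    ∫ y, stepSub y x ∂μ = (μ.real (Iic x) : ℂ) - (Ici 0).indicator 1 x := by
  simp only [stepSub_eq]
  rw [integral_sub ((integrable_const 1).indicator measurableSet_Iic) (integrable_const _),
    integral_const, integral_indicator measurableSet_Iic]
  simp

lemma integrable_cdf_sub_step (hμ : Integrable id μ) :
    Integrable fun x => (μ.real (Iic x) : ℂ) - (Ici (0 : ℝ)).indicator 1 x := by
  simpa only [integral_stepSub, Function.uncurry_apply_pair] using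
    (integrable_uncurry_stepSub hμ).integral_prod_right

lemma integral_exp_mul_cdf_sub_step (hμ : Integrable id μ) {t : ℝ} (ht : t ≠ 0) :
    ∫ x : ℝ, Complex.exp (t * x * I) *
        ((μ.real (Iic x) : ℂ) - (Ici (0 : ℝ)).indicator 1 x) =
      (1 - charFun μ t) / (t * I) := by
  have hne : (t : ℂ) * I ≠ 0 := by simp [ht]
  have hnorm (x : ℝ) : ‖Complex.exp (t * x * I)‖ = 1 := by
    exact_mod_cast Complex.norm_exp_ofReal_mul_I (t * x)
  have hprod : Integrable (Function.uncurry fun y x : ℝ =>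
      Complex.exp (t * x * I) * stepSub y x) (μ.prod volume) :=
    (integrable_uncurry_stepSub hμ).bdd_mul (c := 1)
      (f := fun p : ℝ × ℝ => Complex.exp (t * p.2 * I))
      (by fun_prop) (.of_forall fun p => (hnorm p.2).le)
  have hinner (y : ℝ) : ∫ x : ℝ, Complex.exp (t * x * I) * stepSub y x =
      (1 - Complex.exp (t * y * I)) / (t * I) := by
    rw [integral_mul_stepSub (by fun_prop)]
    simp only [mul_right_comm (t : ℂ) _ I]
    simp [integral_exp_mul_complex hne]
  simp only [← integral_stepSub, ← integral_const_mul]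
  rw [← integral_integral_swap hprod]
  simp only [hinner]
  rw [integral_div, integral_sub (integrable_const 1)
    (.of_bound (by fun_prop) 1 (.of_forall fun y => (hnorm y).le)), charFun_apply_real]
  simp

lemma integrable_cdf_sub_cdf (hμ : Integrable id μ) (hν : Integrable id ν) :
    Integrable fun x => (μ.real (Iic x) - ν.real (Iic x) : ℂ) := by
  simpa [Pi.sub_def] using (integrable_cdf_sub_step hμ).sub (integrable_cdf_sub_step hν)

lemma fourier_cdf_sub_cdf (hμ : Integrable id μ) (hν : Integrable id ν) {w : ℝ} (hw : w ≠ 0) :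
    𝓕 (fun x => (μ.real (Iic x) - ν.real (Iic x) : ℂ)) w =
      (charFun ν (-2 * π * w) - charFun μ (-2 * π * w)) / ((-2 * π * w : ℝ) * I) := by
  have ht : -2 * π * w ≠ 0 := by simp [hw, Real.pi_ne_zero]
  have hint {η : Measure ℝ} [IsProbabilityMeasure η] (hη : Integrable id η) :
      Integrable fun x : ℝ => Complex.exp ((-2 * π * w : ℝ) * x * I) *
        ((η.real (Iic x) : ℂ) - (Ici (0 : ℝ)).indicator 1 x) := by
    refine (integrable_cdf_sub_step hη).bdd_mul (c := 1) (by fun_prop) (.of_forall fun x => ?_)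
    exact_mod_cast (Complex.norm_exp_ofReal_mul_I (-2 * π * w * x)).le
  have hsplit (x : ℝ) : Complex.exp (((-2 * π * x * w : ℝ) : ℂ) * I) •
        (μ.real (Iic x) - ν.real (Iic x) : ℂ) =
      Complex.exp ((-2 * π * w : ℝ) * x * I) *
          ((μ.real (Iic x) : ℂ) - (Ici (0 : ℝ)).indicator 1 x) -
        Complex.exp ((-2 * π * w : ℝ) * x * I) *
          ((ν.real (Iic x) : ℂ) - (Ici (0 : ℝ)).indicator 1 x) := by
    rw [← mul_sub, sub_sub_sub_cancel_right, smul_eq_mul, ← Complex.ofReal_mul,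
      mul_right_comm (-2 * π)]
  rw [Real.fourier_real_eq_integral_exp_smul]
  simp only [hsplit]
  rw [integral_sub (hint hμ) (hint hν), integral_exp_mul_cdf_sub_step hμ ht,
    integral_exp_mul_cdf_sub_step hν ht]
  ring

/- Common continuity points are dense, and distribution functions are right-continuous. -/
lemma abs_cdf_sub_cdf_le_of_continuousAt {C : ℝ}
    (h : ∀ y, ContinuousAt (fun z => μ.real (Iic z)) y → ContinuousAt (fun z => ν.real (Iic z)) y →
      |μ.real (Iic y) - ν.real (Iic y)| ≤ C) (x : ℝ) :
    |μ.real (Iic x) - ν.real (Iic x)| ≤ C := by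
  simp only [← cdf_eq_real] at h ⊢
  have hdense : Dense {y | ContinuousAt (cdf μ) y ∧ ContinuousAt (cdf ν) y} := by
    refine (((monotone_cdf μ).countable_not_continuousAt.union
      (monotone_cdf ν).countable_not_continuousAt).dense_compl ℝ).mono fun y hy => ?_
    simpa [not_or] using hy
  have hlim : Tendsto (fun y => |cdf μ y - cdf ν y|) (𝓝[>] x) (𝓝 |cdf μ x - cdf ν x|) :=
    ((((cdf μ).right_continuous x).sub ((cdf ν).right_continuous x)).mono Ioi_subset_Ici_self).abs
  refine le_of_tendsto_of_frequently hlim (frequently_iff.2 fun {U} hU => ?_)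
  obtain ⟨u, hu, hsub⟩ := mem_nhdsGT_iff_exists_Ioo_subset.1 hU
  obtain ⟨y, ⟨hμ, hν⟩, hy⟩ := hdense.exists_mem_open isOpen_Ioo (nonempty_Ioo.2 hu)
  exact ⟨y, hsub hy, h y hμ hν⟩

theorem abs_cdf_sub_cdf_le_integral (hμ : Integrable id μ) (hν : Integrable id ν) {g : ℝ → ℝ}
    (hg : Integrable g) (hle : ∀ s, s ≠ 0 → ‖charFun μ s - charFun ν s‖ / |s| ≤ g s) (x : ℝ) :
    |μ.real (Iic x) - ν.real (Iic x)| ≤ 1 / (2 * π) * ∫ s, g s := by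
  set D : ℝ → ℂ := fun x => (μ.real (Iic x) - ν.real (Iic x) : ℂ) with hD
  have hDint : Integrable D := integrable_cdf_sub_cdf hμ hν
  have hscale : -2 * π ≠ 0 := by simp [Real.pi_ne_zero]
  have hg' : Integrable fun w : ℝ => g (-2 * π * w) := hg.comp_mul_left' hscale
  have hFle : ∀ᵐ w : ℝ, ‖𝓕 D w‖ ≤ g (-2 * π * w) := by
    filter_upwards [Measure.ae_ne volume 0] with w hw
    refine le_of_eq_of_le ?_ (hle _ (mul_ne_zero hscale hw))
    rw [fourier_cdf_sub_cdf hμ hν hw, norm_div, norm_sub_rev, norm_mul, Complex.norm_I, mul_one,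
      Complex.norm_real, Real.norm_eq_abs]
  have hFcont : Continuous (𝓕 D) := VectorFourier.fourierIntegral_continuous
    Real.continuous_fourierChar (by exact continuous_inner) hDint
  have hFint : Integrable (𝓕 D) := hg'.mono' hFcont.aestronglyMeasurable hFle
  refine abs_cdf_sub_cdf_le_of_continuousAt (fun y hyμ hyν => ?_) x
  have hDy : ContinuousAt D y :=
    (Complex.continuous_ofReal.continuousAt.comp hyμ).sub
      (Complex.continuous_ofReal.continuousAt.comp hyν)
  calc |μ.real (Iic y) - ν.real (Iic y)| = ‖𝓕⁻ (𝓕 D) y‖ := by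
        rw [hDint.fourierInv_fourier_eq hFint hDy]
        simp only [hD, ← Complex.ofReal_sub, Complex.norm_real, Real.norm_eq_abs]
    _ ≤ ∫ w, ‖𝓕 D w‖ := by
        rw [Real.fourierInv_eq']
        refine (norm_integral_le_integral_norm _).trans_eq ?_
        simp only [norm_smul, Complex.norm_exp_ofReal_mul_I, one_mul]
    _ ≤ ∫ w, g (-2 * π * w) := integral_mono_ae hFint.norm hg' hFle
    _ = 1 / (2 * π) * ∫ s, g s := by
        rw [Measure.integral_comp_mul_left]
        simp [abs_of_pos Real.pi_pos, mul_comm]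

end FourierInversion

section LogCharSq

/-- The logarithm of the characteristic function of `ξ² - 1` for a standard normal `ξ`, in the
branch that is continuous in `u` and vanishes at `0`. -/
def logCharSq (u : ℝ) : ℂ := -(1 / 2) * Complex.log (1 - 2 * u * I) - u * I

lemma one_sub_two_mul_I_mem_slitPlane (u : ℝ) : 1 - 2 * u * I ∈ Complex.slitPlane := by
  left; simp

lemma one_sub_two_mul_I_ne_zero (u : ℝ) : 1 - 2 * u * I ≠ 0 :=
  Complex.slitPlane_ne_zero (one_sub_two_mul_I_mem_slitPlane u)

lemma norm_exp_logCharSq (u : ℝ) :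
    ‖Complex.exp (logCharSq u)‖ = (1 + 4 * u ^ 2) ^ (-(1 / 4) : ℝ) := by
  have hpos : 0 < 1 + 4 * u ^ 2 := by positivity
  have hnorm : ‖1 - 2 * u * I‖ = (1 + 4 * u ^ 2) ^ (1 / 2 : ℝ) := by
    rw [Complex.norm_def, ← Real.sqrt_eq_rpow, Complex.normSq_apply]
    congr 1
    simp
    ring
  have hre : (logCharSq u).re = -(1 / 2) * (Complex.log (1 - 2 * u * I)).re := by simp [logCharSq]
  rw [Complex.norm_exp, hre, Complex.log_re, hnorm, Real.log_rpow hpos, Real.rpow_def_of_pos hpos]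
  ring_nf

lemma hasDerivAt_logCharSq_add_sq (u : ℝ) :
    HasDerivAt (fun u : ℝ => logCharSq u + (u : ℂ) ^ 2) (-4 * I * u ^ 2 / (1 - 2 * u * I)) u := by
  have hcoe : HasDerivAt (fun u : ℝ => (u : ℂ)) 1 u := Complex.ofRealCLM.hasDerivAt
  have hlin : HasDerivAt (fun u : ℝ => 1 - 2 * u * I) (-(2 * I)) u :=
    (((hcoe.const_mul 2).mul_const I).const_sub 1).congr_deriv (by ring)
  have hlog := (hlin.clog_real (one_sub_two_mul_I_mem_slitPlane u)).const_mul (-(1 / 2))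
  refine ((hlog.sub (hcoe.mul_const I)).add (hcoe.pow 2)).congr_deriv ?_
  have hne := one_sub_two_mul_I_ne_zero u
  set w := 1 - 2 * u * I with hw
  push_cast
  field_simp
  linear_combination (2 * u - I) * hw + 2 * u * Complex.I_sq

lemma norm_deriv_logCharSq_add_sq_le (u : ℝ) :
    ‖-4 * I * u ^ 2 / (1 - 2 * u * I)‖ ≤ 4 * u ^ 2 := by
  have hone : 1 ≤ ‖1 - 2 * u * I‖ := by
    simpa using Complex.abs_re_le_norm (1 - 2 * u * I)
  calc ‖-4 * I * u ^ 2 / (1 - 2 * u * I)‖ ≤ ‖-4 * I * u ^ 2‖ := by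
        rw [norm_div]
        exact div_le_self (norm_nonneg _) hone
    _ = 4 * u ^ 2 := by simp

lemma norm_logCharSq_add_sq_le (u : ℝ) : ‖logCharSq u + (u : ℂ) ^ 2‖ ≤ 4 / 3 * |u| ^ 3 := by
  have hcont : Continuous fun x : ℝ => -4 * I * x ^ 2 / (1 - 2 * x * I) :=
    .div (by fun_prop) (by fun_prop) one_sub_two_mul_I_ne_zero
  have hftc : ∫ x in (0 : ℝ)..u, -4 * I * x ^ 2 / (1 - 2 * x * I) = logCharSq u + (u : ℂ) ^ 2 := by
    rw [intervalIntegral.integral_eq_sub_of_hasDerivAt (fun x _ => hasDerivAt_logCharSq_add_sq x)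
      (hcont.intervalIntegrable _ _)]
    simp [logCharSq]
  calc ‖logCharSq u + (u : ℂ) ^ 2‖ ≤ |∫ x in (0 : ℝ)..u, 4 * x ^ 2| := by
        rw [← hftc]
        exact intervalIntegral.norm_integral_le_abs_of_norm_le
          (.of_forall fun x => norm_deriv_logCharSq_add_sq_le x)
          (Continuous.intervalIntegrable (by fun_prop) _ _)
    _ = 4 / 3 * |u| ^ 3 := by
        rw [intervalIntegral.integral_const_mul, integral_pow, abs_mul, abs_div, ← abs_pow]
        norm_num
        ring

lemma sqrt_two_pi_eq_exp : ((√(2 * π) : ℝ) : ℂ) = Complex.exp (Real.log (2 * π) * (1 / 2)) := by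
  rw [Real.sqrt_eq_rpow, Real.rpow_def_of_pos (by positivity)]
  push_cast
  ring_nf

lemma integral_exp_mul_sq_sub_one_gaussianReal (u : ℝ) :
    ∫ x : ℝ, Complex.exp (u * (x ^ 2 - 1) * I) ∂gaussianReal 0 1 = Complex.exp (logCharSq u) := by
  have hne := one_sub_two_mul_I_ne_zero u
  have hdens (x : ℝ) : gaussianPDFReal 0 1 x • Complex.exp (u * (x ^ 2 - 1) * I) =
      ((√(2 * π) : ℝ) : ℂ)⁻¹ * Complex.exp (-(u * I)) *
        Complex.exp (-((1 - 2 * u * I) / 2) * x ^ 2) := by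
    simp only [gaussianPDFReal, NNReal.coe_one, mul_one, sub_zero, Complex.real_smul]
    push_cast
    rw [mul_assoc, ← Complex.exp_add, mul_assoc (_)⁻¹, ← Complex.exp_add]
    ring_nf
  have hquot : (π : ℂ) / ((1 - 2 * u * I) / 2) = ((2 * π : ℝ) : ℂ) * (1 - 2 * u * I)⁻¹ := by
    push_cast
    field_simp
  rw [integral_gaussianReal_eq_integral_smul one_ne_zero]
  simp only [hdens]
  rw [integral_const_mul, integral_gaussian_complex (by simp), hquot,
    Complex.cpow_def_of_ne_zero (mul_ne_zero (by simp [Real.pi_ne_zero]) (inv_ne_zero hne)),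
    Complex.log_ofReal_mul Real.two_pi_pos (inv_ne_zero hne),
    Complex.log_inv _ (Complex.slitPlane_arg_ne_pi (one_sub_two_mul_I_mem_slitPlane u)),
    sqrt_two_pi_eq_exp, ← Complex.exp_neg, ← Complex.exp_add, ← Complex.exp_add, logCharSq]
  ring_nf

lemma charFun_map_mul_sq_sub_one (τ t : ℝ) :
    charFun ((gaussianReal 0 1).map fun x => τ * (x ^ 2 - 1)) t =
      Complex.exp (logCharSq (τ * t)) := by
  rw [charFun_apply_real, integral_map (by fun_prop) (by fun_prop),
    ← integral_exp_mul_sq_sub_one_gaussianReal]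
  congr! 3 with x
  push_cast
  ring

end LogCharSq

section ChiSqMoments

lemma integral_pow_two_mul_gaussianReal (j : ℕ) :
    ∫ x, x ^ (2 * j) ∂gaussianReal 0 1 = ((2 * j - 1).doubleFactorial : ℝ) := by
  have hdens (x : ℝ) : gaussianPDFReal 0 1 x • x ^ (2 * j) =
      (√(2 * π))⁻¹ * (|x| ^ (2 * j : ℝ) * Real.exp (-(1 / 2) * |x| ^ (2 : ℝ))) := by
    have habs : |x| ^ (2 * j : ℝ) = x ^ (2 * j) := by
      exact_mod_cast (even_two_mul j).pow_abs x
    rw [habs, Real.rpow_two, sq_abs]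
    simp only [gaussianPDFReal, NNReal.coe_one, mul_one, sub_zero, smul_eq_mul]
    ring_nf
  have hpow : ((1 : ℝ) / 2) ^ (-(2 * j + 1) / 2 : ℝ) = 2 ^ j * √2 := by
    rw [show (-(2 * j + 1) / 2 : ℝ) = -(j + 1 / 2) by ring, one_div, Real.inv_rpow two_pos.le,
      Real.rpow_neg two_pos.le, inv_inv, Real.rpow_add two_pos, Real.rpow_natCast,
      Real.sqrt_eq_rpow, one_div]
  rw [integral_gaussianReal_eq_integral_smul one_ne_zero]
  simp only [hdens]
  rw [integral_const_mul, integral_comp_abs (f := fun x : ℝ =>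
      x ^ (2 * j : ℝ) * Real.exp (-(1 / 2) * x ^ (2 : ℝ))),
    integral_rpow_mul_exp_neg_mul_rpow two_pos (by linarith [j.cast_nonneg (α := ℝ)]) one_half_pos,
    hpow, show (2 * j + 1 : ℝ) / 2 = j + 1 / 2 by ring, Real.Gamma_nat_add_half,
    Real.sqrt_mul two_pos.le]
  field_simp

lemma integral_sq_sub_one_pow_gaussianReal (m : ℕ) :
    ∫ x, (x ^ 2 - 1) ^ m ∂gaussianReal 0 1 =
      ∑ k ∈ Finset.range (m + 1),
        ((2 * k - 1).doubleFactorial : ℝ) * ((-1) ^ (m - k) * m.choose k) := by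
  have hint (k : ℕ) : Integrable (fun x : ℝ => x ^ (2 * k)) (gaussianReal 0 1) := by
    have hLp : MemLp id (2 * k : ℕ) (gaussianReal 0 1) :=
      memLp_id_gaussianReal' _ (ENNReal.natCast_ne_top _)
    exact hLp.integrable_norm_pow'.congr' (by fun_prop) (.of_forall fun x => by simp)
  simp only [sub_eq_add_neg, add_pow, ← pow_mul, mul_assoc]
  rw [integral_finsetSum _ fun k _ => (hint k).mul_const _]
  simp only [integral_mul_const, integral_pow_two_mul_gaussianReal]

lemma memLp_sq_sub_one_gaussianReal {p : ENNReal} (hp : p ≠ ⊤) :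
    MemLp (fun x : ℝ => x ^ 2 - 1) p (gaussianReal 0 1) := by
  have hid : MemLp id (p * 2) (gaussianReal 0 1) :=
    memLp_id_gaussianReal' _ (ENNReal.mul_ne_top hp (by simp))
  have hsq := hid.norm_rpow_div 2
  rw [ENNReal.mul_div_cancel_right (by simp) (by simp)] at hsq
  simpa [Pi.sub_def] using hsq.sub (memLp_const 1)

lemma integral_sq_sub_one_gaussianReal : ∫ x, (x ^ 2 - 1) ∂gaussianReal 0 1 = 0 := by
  simpa [Finset.sum_range_succ] using integral_sq_sub_one_pow_gaussianReal 1

lemma variance_sq_sub_one_gaussianReal : Var[fun x => x ^ 2 - 1; gaussianReal 0 1] = 2 := by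
  rw [variance_of_integral_eq_zero (by fun_prop) integral_sq_sub_one_gaussianReal,
    integral_sq_sub_one_pow_gaussianReal]
  norm_num [Finset.sum_range_succ, Nat.doubleFactorial]

lemma integral_sq_sub_one_pow_three_gaussianReal :
    ∫ x, (x ^ 2 - 1) ^ 3 ∂gaussianReal 0 1 = 8 := by
  rw [integral_sq_sub_one_pow_gaussianReal]
  norm_num [Finset.sum_range_succ, Nat.doubleFactorial, Nat.choose]

section ThirdMoment

variable {Ω ι : Type*} [MeasurableSpace Ω] {P : Measure Ω}

lemma integrable_pow_three_of_memLp {X : Ω → ℝ} (hX : MemLp X 3 P) :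
    Integrable (fun ω => X ω ^ 3) P :=
  (hX.integrable_norm_pow three_ne_zero).congr' (hX.1.pow 3) (.of_forall fun ω => by simp)

variable [IsFiniteMeasure P]

lemma integral_add_pow_three_of_indepFun {X Y : Ω → ℝ} (hXY : IndepFun X Y P) (hX : MemLp X 3 P)
    (hY : MemLp Y 3 P) (hX0 : ∫ ω, X ω ∂P = 0) (hY0 : ∫ ω, Y ω ∂P = 0) :
    ∫ ω, (X ω + Y ω) ^ 3 ∂P = ∫ ω, X ω ^ 3 ∂P + ∫ ω, Y ω ^ 3 ∂P := by
  have hX1 : Integrable X P := hX.integrable (by norm_num)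
  have hY1 : Integrable Y P := hY.integrable (by norm_num)
  have hX2 : Integrable (fun ω => X ω ^ 2) P := (hX.mono_exponent (by norm_num)).integrable_sq
  have hY2 : Integrable (fun ω => Y ω ^ 2) P := (hY.mono_exponent (by norm_num)).integrable_sq
  have hX3 := integrable_pow_three_of_memLp hX
  have hY3 := integrable_pow_three_of_memLp hY
  have hX2Y : IndepFun (fun ω => X ω ^ 2) Y P := hXY.comp (measurable_id.pow_const 2) measurable_id
  have hXY2 : IndepFun X (fun ω => Y ω ^ 2) P := hXY.comp measurable_id (measurable_id.pow_const 2)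
  have hmixed₁ : Integrable (fun ω => 3 * (X ω ^ 2 * Y ω)) P :=
    (hX2Y.integrable_mul hX2 hY1).const_mul 3
  have hmixed₂ : Integrable (fun ω => 3 * (X ω * Y ω ^ 2)) P :=
    (hXY2.integrable_mul hX1 hY2).const_mul 3
  have hcubes : Integrable (fun ω => X ω ^ 3 + Y ω ^ 3) P := hX3.add hY3
  have hmixed : Integrable (fun ω => 3 * (X ω ^ 2 * Y ω) + 3 * (X ω * Y ω ^ 2)) P :=
    hmixed₁.add hmixed₂
  calc ∫ ω, (X ω + Y ω) ^ 3 ∂P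
      = ∫ ω, (X ω ^ 3 + Y ω ^ 3) + (3 * (X ω ^ 2 * Y ω) + 3 * (X ω * Y ω ^ 2)) ∂P := by
        congr with ω
        ring
    _ = ∫ ω, X ω ^ 3 ∂P + ∫ ω, Y ω ^ 3 ∂P := by
        rw [integral_add hcubes hmixed, integral_add hX3 hY3,
          integral_add hmixed₁ hmixed₂, integral_const_mul, integral_const_mul,
          hX2Y.integral_fun_mul_eq_mul_integral hX2.1 hY1.1,
          hXY2.integral_fun_mul_eq_mul_integral hX1.1 hY2.1, hX0, hY0]
        ring

lemma integral_sum_pow_three_of_iIndepFun {Y : ι → Ω → ℝ} (hind : iIndepFun Y P)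
    (hmeas : ∀ i, Measurable (Y i)) (hLp : ∀ i, MemLp (Y i) 3 P) (h0 : ∀ i, ∫ ω, Y i ω ∂P = 0)
    (s : Finset ι) :
    ∫ ω, (∑ i ∈ s, Y i ω) ^ 3 ∂P = ∑ i ∈ s, ∫ ω, Y i ω ^ 3 ∂P := by
  classical
  induction s using Finset.induction_on with
  | empty => simp
  | insert i s hi ih =>
    have hindep : IndepFun (Y i) (fun ω => ∑ j ∈ s, Y j ω) P := by
      simpa [Finset.sum_fn] using (hind.indepFun_finsetSum_of_notMem hmeas hi).symm
    have hsum0 : ∫ ω, ∑ j ∈ s, Y j ω ∂P = 0 := by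
      rw [integral_finsetSum _ fun j _ => (hLp j).integrable (by norm_num)]
      exact Finset.sum_eq_zero fun j _ => h0 j
    simp only [Finset.sum_insert hi]
    rw [integral_add_pow_three_of_indepFun hindep (hLp i) (memLp_finsetSum s fun j _ => hLp j)
      (h0 i) hsum0, ih]

end ThirdMoment

section ChiSqLaw

variable {ι : Type*} [Fintype ι]

/-- The law of the weighted sum `∑ i, τ i * (ξ i ^ 2 - 1)` of centred `χ²` variables, where the
`ξ i` are i.i.d. standard normal. -/
def chiSqLaw (τ : ι → ℝ) : Measure ℝ :=
  (Measure.pi fun _ : ι => gaussianReal 0 1).map fun e => ∑ i, τ i * (e i ^ 2 - 1)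

variable (τ : ι → ℝ)

lemma measurable_sum_mul_sq_sub_one : Measurable fun e : ι → ℝ => ∑ i, τ i * (e i ^ 2 - 1) := by
  fun_prop

instance : IsProbabilityMeasure (chiSqLaw τ) :=
  Measure.isProbabilityMeasure_map (measurable_sum_mul_sq_sub_one τ).aemeasurable

lemma memLp_mul_sq_sub_one_pi (i : ι) : MemLp (fun e : ι → ℝ => τ i * (e i ^ 2 - 1)) 3
    (Measure.pi fun _ : ι => gaussianReal 0 1) :=
  ((memLp_sq_sub_one_gaussianReal (by simp)).const_mul (τ i)).comp_measurePreserving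
    (measurePreserving_eval (fun _ : ι => gaussianReal 0 1) i)

lemma integral_mul_sq_sub_one_pow_pi (i : ι) (m : ℕ) :
    ∫ e : ι → ℝ, (τ i * (e i ^ 2 - 1)) ^ m ∂(Measure.pi fun _ : ι => gaussianReal 0 1) =
      τ i ^ m * ∫ x, (x ^ 2 - 1) ^ m ∂gaussianReal 0 1 := by
  rw [integral_comp_eval (μ := fun _ : ι => gaussianReal 0 1)
    (f := fun x : ℝ => (τ i * (x ^ 2 - 1)) ^ m) (by fun_prop)]
  simp only [mul_pow, integral_const_mul]

lemma integral_mul_sq_sub_one_pi (i : ι) :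
    ∫ e : ι → ℝ, τ i * (e i ^ 2 - 1) ∂(Measure.pi fun _ : ι => gaussianReal 0 1) = 0 := by
  simpa [integral_sq_sub_one_gaussianReal] using integral_mul_sq_sub_one_pow_pi τ i 1

lemma integrable_id_chiSqLaw : Integrable id (chiSqLaw τ) := by
  rw [chiSqLaw, integrable_map_measure (by fun_prop)
    (measurable_sum_mul_sq_sub_one τ).aemeasurable]
  exact integrable_finsetSum _ fun i _ => (memLp_mul_sq_sub_one_pi τ i).integrable (by norm_num)

lemma charFun_chiSqLaw (t : ℝ) :
    charFun (chiSqLaw τ) t = Complex.exp (∑ i, logCharSq (τ i * t)) := by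
  have hsum : chiSqLaw τ = (Measure.pi fun i => (gaussianReal 0 1).map
      fun x => τ i * (x ^ 2 - 1)).map fun y => ∑ i, y i := by
    rw [← Measure.pi_map_pi (fun i => by fun_prop), Measure.map_map (by fun_prop) (by fun_prop)]
    rfl
  have (i : ι) : IsProbabilityMeasure ((gaussianReal 0 1).map fun x => τ i * (x ^ 2 - 1)) :=
    Measure.isProbabilityMeasure_map (by fun_prop)
  simp only [hsum, charFun_map_sum_pi_eq_prod, Finset.prod_apply, charFun_map_mul_sq_sub_one,
    Complex.exp_sum]

lemma integral_id_chiSqLaw : ∫ y, y ∂chiSqLaw τ = 0 := by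
  rw [chiSqLaw, integral_map (measurable_sum_mul_sq_sub_one τ).aemeasurable (by fun_prop),
    integral_finsetSum _ fun i _ => (memLp_mul_sq_sub_one_pi τ i).integrable (by norm_num)]
  exact Finset.sum_eq_zero fun i _ => integral_mul_sq_sub_one_pi τ i

lemma variance_chiSqLaw : Var[id; chiSqLaw τ] = 2 * ∑ i, τ i ^ 2 := by
  have hsum := variance_sum_pi (μ := fun _ : ι => gaussianReal 0 1)
    (X := fun i x => τ i * (x ^ 2 - 1))
    fun i => (memLp_sq_sub_one_gaussianReal (by simp)).const_mul (τ i)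
  rw [chiSqLaw, variance_id_map (measurable_sum_mul_sq_sub_one τ).aemeasurable]
  simpa [Finset.sum_fn, variance_const_mul, variance_sq_sub_one_gaussianReal, ← Finset.sum_mul,
    mul_comm] using hsum

lemma integral_pow_three_chiSqLaw : ∫ y, y ^ 3 ∂chiSqLaw τ = 8 * ∑ i, τ i ^ 3 := by
  have hind : iIndepFun (fun i (e : ι → ℝ) => τ i * (e i ^ 2 - 1))
      (Measure.pi fun _ : ι => gaussianReal 0 1) :=
    iIndepFun_pi (X := fun i x => τ i * (x ^ 2 - 1)) fun i => by fun_prop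
  rw [chiSqLaw, integral_map (measurable_sum_mul_sq_sub_one τ).aemeasurable (by fun_prop),
    integral_sum_pow_three_of_iIndepFun hind (fun i => by fun_prop) (memLp_mul_sq_sub_one_pi τ)
    (integral_mul_sq_sub_one_pi τ)]
  simp only [integral_mul_sq_sub_one_pow_pi, integral_sq_sub_one_pow_three_gaussianReal,
    ← Finset.sum_mul, mul_comm]

lemma skewness_chiSqLaw :
    skewness (chiSqLaw τ) = 8 * (∑ i, τ i ^ 3) / (2 * ∑ i, τ i ^ 2) ^ (3 / 2 : ℝ) := by
  simp only [skewness, integral_id_chiSqLaw, sub_zero, integral_pow_three_chiSqLaw,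
    variance_chiSqLaw]

lemma map_const_mul_chiSqLaw (c : ℝ) :
    (chiSqLaw τ).map (fun y => c * y) = chiSqLaw fun i => c * τ i := by
  rw [chiSqLaw, Measure.map_map (by fun_prop) (by fun_prop), chiSqLaw]
  simp only [Function.comp_def, Finset.mul_sum, mul_assoc]

end ChiSqLaw

end ChiSqMoments

section GaussianComparison

lemma one_add_sum_add_le_prod {ι : Type*} (s : Finset ι) {a : ι → ℝ} (ha : ∀ i, 0 ≤ a i) :
    1 + ∑ i ∈ s, a i + ((∑ i ∈ s, a i) ^ 2 - ∑ i ∈ s, a i ^ 2) / 2 ≤ ∏ i ∈ s, (1 + a i) := by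
  classical
  induction s using Finset.induction_on with
  | empty => simp
  | insert i s hi ih =>
    have hsq : ∑ j ∈ s, a j ^ 2 ≤ (∑ j ∈ s, a j) ^ 2 :=
      Finset.sum_sq_le_sq_sum_of_nonneg fun j _ => ha j
    rw [Finset.sum_insert hi, Finset.sum_insert hi, Finset.prod_insert hi]
    nlinarith [ha i, mul_nonneg (ha i) (sub_nonneg.2 ih), mul_nonneg (ha i) (sub_nonneg.2 hsq)]

variable {ι : Type*} [Fintype ι] {τ : ι → ℝ} {D : ℝ}

lemma one_sub_div_two_mul_sq_sum_le_prod {a : ι → ℝ} (ha : ∀ i, 0 ≤ a i)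
    (haD : ∀ i, a i ≤ D * ∑ j, a j) : (1 - D) / 2 * (∑ i, a i) ^ 2 ≤ ∏ i, (1 + a i) := by
  have hsq : ∑ i, a i ^ 2 ≤ D * (∑ i, a i) ^ 2 := by
    calc ∑ i, a i ^ 2 ≤ ∑ i, D * (∑ j, a j) * a i := by
          refine Finset.sum_le_sum fun i _ => ?_
          rw [sq]
          exact mul_le_mul_of_nonneg_right (haD i) (ha i)
      _ = D * (∑ i, a i) ^ 2 := by rw [← Finset.mul_sum]; ring
  have hsum : 0 ≤ ∑ i, a i := Finset.sum_nonneg fun i _ => ha i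
  linarith [one_add_sum_add_le_prod Finset.univ ha]

lemma two_mul_sq_rpow_neg_quarter {k d : ℝ} (hk : 0 ≤ k) (hd : 0 ≤ d) (s : ℝ) :
    (2 * (k * d * s ^ 2) ^ 2) ^ (-(1 / 4) : ℝ) =
      2 ^ (-(1 / 4) : ℝ) * k ^ (-(1 / 2) : ℝ) / √d / |s| := by
  have hsq (x : ℝ) (hx : 0 ≤ x) : (x ^ 2) ^ (-(1 / 4) : ℝ) = x ^ (-(1 / 2) : ℝ) := by
    rw [← Real.rpow_natCast, ← Real.rpow_mul hx]
    norm_num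
  rw [Real.mul_rpow two_pos.le (by positivity), hsq _ (by positivity),
    Real.mul_rpow (by positivity) (sq_nonneg s), Real.mul_rpow hk hd, Real.rpow_neg hd,
    Real.rpow_neg (sq_nonneg s), ← Real.sqrt_eq_rpow, ← Real.sqrt_eq_rpow, Real.sqrt_sq_eq_abs]
  field_simp

lemma two_mul_pi_sq_mul_R₂ (D : ℝ) : 2 * π ^ 2 * R₂ D = 2 ^ (-(1 / 4) : ℝ) / √(1 - 2 * D) := by
  rw [R₂, show (-(5 / 4) : ℝ) = -(1 / 4) + -1 by norm_num, Real.rpow_add two_pos,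
    Real.rpow_neg_one, Real.rpow_neg Real.pi_pos.le, Real.rpow_two]
  field_simp

lemma two_mul_pi_sq_mul_R₃ : 2 * π ^ 2 * R₃ = (2 * π) ^ (-(3 / 2) : ℝ) / 2 := by
  rw [R₃, show (-(7 / 2) : ℝ) = -(3 / 2) + -2 by norm_num, Real.rpow_add Real.two_pi_pos,
    Real.rpow_neg Real.two_pi_pos.le 2, Real.rpow_two]
  field_simp

lemma norm_charFun_chiSqLaw (τ : ι → ℝ) (s : ℝ) :
    ‖charFun (chiSqLaw τ) s‖ = (∏ i, (1 + 4 * (τ i * s) ^ 2)) ^ (-(1 / 4) : ℝ) := by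
  rw [charFun_chiSqLaw, Complex.exp_sum, norm_prod,
    ← Real.finsetProd_rpow _ _ fun i _ => by positivity]
  simp only [norm_exp_logCharSq]

lemma nonneg_of_sq_le_mul_sum_sq (hτ : ∀ i, τ i ^ 2 ≤ D * ∑ j, τ j ^ 2)
    (hτ0 : 0 < ∑ i, τ i ^ 2) : 0 ≤ D := by
  obtain ⟨i, -, -⟩ := Finset.exists_ne_zero_of_sum_ne_zero hτ0.ne'
  exact nonneg_of_mul_nonneg_left ((sq_nonneg (τ i)).trans (hτ i)) hτ0

lemma norm_charFun_chiSqLaw_le (hD : D < 1 / 2) (hτ : ∀ i, τ i ^ 2 ≤ D * ∑ j, τ j ^ 2)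
    (hτ0 : 0 < ∑ i, τ i ^ 2) {s : ℝ} (hs : s ≠ 0) :
    ‖charFun (chiSqLaw τ) s‖ ≤ 2 * π ^ 2 * (R₂ D * (2 * ∑ i, τ i ^ 2) ^ (-(1 / 2) : ℝ)) / |s| := by
  have hD0 := nonneg_of_sq_le_mul_sum_sq hτ hτ0
  have hd : 0 < 1 - 2 * D := by linarith
  have hsum : ∑ i, 4 * (τ i * s) ^ 2 = 4 * s ^ 2 * ∑ i, τ i ^ 2 := by
    rw [Finset.mul_sum]
    exact Finset.sum_congr rfl fun i _ => by ring
  have hmax (i : ι) : 4 * (τ i * s) ^ 2 ≤ D * ∑ j, 4 * (τ j * s) ^ 2 := by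
    rw [hsum]
    calc 4 * (τ i * s) ^ 2 = 4 * s ^ 2 * τ i ^ 2 := by ring
      _ ≤ 4 * s ^ 2 * (D * ∑ j, τ j ^ 2) := by gcongr; exact hτ i
      _ = D * (4 * s ^ 2 * ∑ j, τ j ^ 2) := by ring
  have hprod : 2 * (2 * (∑ i, τ i ^ 2) * (1 - 2 * D) * s ^ 2) ^ 2 ≤
      ∏ i, (1 + 4 * (τ i * s) ^ 2) := by
    calc 2 * (2 * (∑ i, τ i ^ 2) * (1 - 2 * D) * s ^ 2) ^ 2
        = 8 * ((∑ i, τ i ^ 2) * s ^ 2) ^ 2 * (1 - 2 * D) ^ 2 := by ring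
      _ ≤ 8 * ((∑ i, τ i ^ 2) * s ^ 2) ^ 2 * (1 - D) := by gcongr; nlinarith
      _ = (1 - D) / 2 * (∑ i, 4 * (τ i * s) ^ 2) ^ 2 := by rw [hsum]; ring
      _ ≤ ∏ i, (1 + 4 * (τ i * s) ^ 2) :=
          one_sub_div_two_mul_sq_sum_le_prod (fun i => by positivity) hmax
  calc ‖charFun (chiSqLaw τ) s‖
      ≤ (2 * (2 * (∑ i, τ i ^ 2) * (1 - 2 * D) * s ^ 2) ^ 2) ^ (-(1 / 4) : ℝ) := by
        rw [norm_charFun_chiSqLaw]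
        exact Real.rpow_le_rpow_of_nonpos (by positivity) hprod (by norm_num)
    _ = 2 * π ^ 2 * (R₂ D * (2 * ∑ i, τ i ^ 2) ^ (-(1 / 2) : ℝ)) / |s| := by
        rw [two_mul_sq_rpow_neg_quarter (by positivity) hd.le, ← mul_assoc, two_mul_pi_sq_mul_R₂]
        ring

lemma norm_charFun_gaussianReal_one (b s : ℝ) :
    ‖charFun (gaussianReal b 1) s‖ = Real.exp (-(1 / 2) * s ^ 2) := by
  have hre : (s * b * I - s ^ 2 / 2 : ℂ) = (s * b : ℝ) * I - (s ^ 2 / 2 : ℝ) := by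
    push_cast
    ring
  rw [charFun_gaussianReal, NNReal.coe_one, Complex.ofReal_one, one_mul, hre, Complex.norm_exp,
    Complex.sub_re, Complex.re_ofReal_mul, Complex.ofReal_re, Complex.I_re]
  ring_nf

lemma exp_neg_sq_div_le {t : ℝ} (ht : 2 * π < t) :
    Real.exp (-(1 / 2) * t ^ 2) / t ≤ 2 * π ^ 2 * R₃ * t ^ (-2 : ℝ) := by
  have ht6 : 6 < t := by linarith [Real.pi_gt_three]
  have hR₃ : (1 : ℝ) / 64 ≤ 2 * π ^ 2 * R₃ := by
    have hten : (1 : ℝ) / 32 ≤ 10 ^ (-(3 / 2) : ℝ) := by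
      rw [show (-(3 / 2) : ℝ) = (-3 : ℤ) * (1 / 2) by norm_num, Real.rpow_mul (by norm_num),
        Real.rpow_intCast, ← Real.sqrt_eq_rpow]
      exact Real.le_sqrt_of_sq_le (by norm_num)
    have hmono : (10 : ℝ) ^ (-(3 / 2) : ℝ) ≤ (2 * π) ^ (-(3 / 2) : ℝ) :=
      Real.rpow_le_rpow_of_nonpos (by positivity) (by linarith [Real.pi_lt_d2]) (by norm_num)
    linarith [two_mul_pi_sq_mul_R₃]
  have hexp : t ^ 6 / 48 ≤ Real.exp (t ^ 2 / 2) := by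
    have hfact := Real.pow_div_factorial_le_exp (t ^ 2 / 2) (by positivity) 3
    norm_num [Nat.factorial] at hfact
    linarith [show (t ^ 2 / 2) ^ 3 / 6 = t ^ 6 / 48 by ring]
  have hpow : 3072 ≤ t ^ 5 := by
    calc (3072 : ℝ) ≤ 6 ^ 5 := by norm_num
      _ ≤ t ^ 5 := by gcongr
  rw [show -(1 / 2) * t ^ 2 = -(t ^ 2 / 2) by ring, Real.exp_neg, Real.rpow_neg (by linarith),
    Real.rpow_two]
  calc (Real.exp (t ^ 2 / 2))⁻¹ / t ≤ (t ^ 6 / 48)⁻¹ / t := by gcongr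
    _ = 48 / t ^ 5 * (t ^ 2)⁻¹ := by field_simp
    _ ≤ 1 / 64 * (t ^ 2)⁻¹ := by
        gcongr ?_ * _
        rw [div_le_iff₀ (by positivity)]
        linarith
    _ ≤ 2 * π ^ 2 * R₃ * (t ^ 2)⁻¹ := by gcongr

/-- The argument of `Psi` in the comparison of `chiSqLaw τ` with `N(b, 1)`: on `|s| ≤ 2π`, the
logarithms of the two characteristic functions at `s` differ by at most `|s| * charFunError τ b`. -/
def charFunError (τ : ι → ℝ) (b : ℝ) : ℝ :=
  16 * π ^ 2 / 3 * ∑ i, |τ i| ^ 3 + |b| + π * |2 * ∑ i, τ i ^ 2 - 1|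

lemma charFunError_nonneg (τ : ι → ℝ) (b : ℝ) : 0 ≤ charFunError τ b := by
  unfold charFunError
  positivity

lemma norm_sum_logCharSq_add_sq_le (τ : ι → ℝ) (s : ℝ) :
    ‖∑ i, (logCharSq (τ i * s) + ((τ i * s : ℝ) : ℂ) ^ 2)‖ ≤
      4 / 3 * (∑ i, |τ i| ^ 3) * |s| ^ 3 := by
  calc ‖∑ i, (logCharSq (τ i * s) + ((τ i * s : ℝ) : ℂ) ^ 2)‖
      ≤ ∑ i, 4 / 3 * |τ i * s| ^ 3 := norm_sum_le_of_le _ fun i _ => norm_logCharSq_add_sq_le _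
    _ = 4 / 3 * (∑ i, |τ i| ^ 3) * |s| ^ 3 := by
        rw [mul_assoc, Finset.sum_mul, Finset.mul_sum]
        simp only [abs_mul, mul_pow]

lemma norm_sum_logCharSq_sub_le (τ : ι → ℝ) (b : ℝ) {s : ℝ} (hs : |s| ≤ 2 * π) :
    ‖∑ i, logCharSq (τ i * s) - (s * b * I - s ^ 2 / 2)‖ ≤ |s| * charFunError τ b := by
  have hsq : ∑ i, ((τ i * s : ℝ) : ℂ) ^ 2 = ((∑ i, τ i ^ 2 : ℝ) : ℂ) * s ^ 2 := by
    push_cast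
    rw [Finset.sum_mul]
    exact Finset.sum_congr rfl fun i _ => by ring
  have hsplit : ∑ i, logCharSq (τ i * s) - (s * b * I - s ^ 2 / 2) =
      ∑ i, (logCharSq (τ i * s) + ((τ i * s : ℝ) : ℂ) ^ 2) - s * b * I -
        (((2 * ∑ i, τ i ^ 2 - 1) * s ^ 2 / 2 : ℝ) : ℂ) := by
    rw [Finset.sum_add_distrib, hsq]
    push_cast
    ring
  have hmean : ‖(s * b * I : ℂ)‖ = |s| * |b| := by simp
  have hvar : ‖(((2 * ∑ i, τ i ^ 2 - 1) * s ^ 2 / 2 : ℝ) : ℂ)‖ =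
      |2 * ∑ i, τ i ^ 2 - 1| * |s| ^ 2 / 2 := by
    rw [Complex.norm_real, Real.norm_eq_abs, abs_div, abs_mul, abs_pow, abs_two]
  have hcube : |s| ^ 3 ≤ |s| * (2 * π) ^ 2 := by
    rw [pow_succ']
    gcongr
  have hquad : |s| ^ 2 ≤ |s| * (2 * π) := by
    rw [sq]
    gcongr
  calc ‖∑ i, logCharSq (τ i * s) - (s * b * I - s ^ 2 / 2)‖
      ≤ 4 / 3 * (∑ i, |τ i| ^ 3) * |s| ^ 3 + |s| * |b| +
          |2 * ∑ i, τ i ^ 2 - 1| * |s| ^ 2 / 2 := by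
        rw [hsplit]
        refine (norm_sub_le _ _).trans (add_le_add ((norm_sub_le _ _).trans (add_le_add ?_ ?_)) ?_)
        exacts [norm_sum_logCharSq_add_sq_le τ s, hmean.le, hvar.le]
    _ ≤ 4 / 3 * (∑ i, |τ i| ^ 3) * (|s| * (2 * π) ^ 2) + |s| * |b| +
          |2 * ∑ i, τ i ^ 2 - 1| * (|s| * (2 * π)) / 2 := by gcongr
    _ = |s| * charFunError τ b := by
        rw [charFunError]
        ring

lemma norm_exp_sub_one_le (z : ℂ) : ‖Complex.exp z - 1‖ ≤ ‖z‖ * Real.exp ‖z‖ := by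
  simpa using Complex.norm_exp_sub_sum_le_norm_mul_exp z 1

lemma norm_charFun_chiSqLaw_sub_gaussianReal_le (τ : ι → ℝ) (b : ℝ) {s : ℝ}
    (hs : |s| ≤ 2 * π) :
    ‖charFun (chiSqLaw τ) s - charFun (gaussianReal b 1) s‖ ≤
      charFunError τ b * Real.exp (2 * π * charFunError τ b) * Real.exp (-(1 / 2) * s ^ 2) *
        |s| := by
  have hy := charFunError_nonneg τ b
  set z : ℂ := ∑ i, logCharSq (τ i * s) - (s * b * I - s ^ 2 / 2) with hz
  have hz_le : ‖z‖ ≤ |s| * charFunError τ b := norm_sum_logCharSq_sub_le τ b hs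
  have hfactor : charFun (chiSqLaw τ) s - charFun (gaussianReal b 1) s =
      charFun (gaussianReal b 1) s * (Complex.exp z - 1) := by
    rw [charFun_chiSqLaw, charFun_gaussianReal, mul_sub_one, ← Complex.exp_add, hz]
    congr 2
    push_cast
    ring
  calc ‖charFun (chiSqLaw τ) s - charFun (gaussianReal b 1) s‖
      ≤ Real.exp (-(1 / 2) * s ^ 2) * (‖z‖ * Real.exp ‖z‖) := by
        rw [hfactor, norm_mul, norm_charFun_gaussianReal_one]
        gcongr
        exact norm_exp_sub_one_le z
    _ ≤ Real.exp (-(1 / 2) * s ^ 2) *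
          (|s| * charFunError τ b * Real.exp (2 * π * charFunError τ b)) := by
        gcongr
        exact hz_le.trans (by gcongr)
    _ = _ := by ring

/-- The function `|t| ^ (-2)` restricted to `|t| > c`, which for `c = 2π` bounds the high-frequency
part of the difference of two characteristic functions divided by `|t|`. -/
def invSqTail (c t : ℝ) : ℝ := (Ioi c).indicator (fun t => t ^ (-2 : ℝ)) |t|

lemma invSqTail_nonneg (c t : ℝ) : 0 ≤ invSqTail c t :=
  indicator_apply_nonneg fun _ => Real.rpow_nonneg (abs_nonneg t) _

lemma integrable_invSqTail {c : ℝ} (hc : 0 < c) : Integrable (invSqTail c) := by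
  have hright : Integrable ((Ioi c).indicator fun t : ℝ => t ^ (-2 : ℝ)) :=
    (integrable_indicator_iff measurableSet_Ioi).2
      (integrableOn_Ioi_rpow_of_lt (by norm_num) hc)
  refine (hright.add hright.comp_neg).congr (.of_forall fun t => ?_)
  simp only [Pi.add_apply, invSqTail, indicator, mem_Ioi]
  rcases le_total 0 t with ht | ht
  · rw [abs_of_nonneg ht, if_neg (by linarith : ¬ c < -t), add_zero]
  · rw [abs_of_nonpos ht, if_neg (by linarith : ¬ c < t), zero_add]

lemma integral_invSqTail {c : ℝ} (hc : 0 < c) : ∫ t, invSqTail c t = 2 / c := by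
  simp only [invSqTail]
  rw [integral_comp_abs, setIntegral_indicator measurableSet_Ioi, Ioi_inter_Ioi,
    max_eq_right hc.le, integral_Ioi_rpow_of_lt (by norm_num) hc]
  norm_num [Real.rpow_neg_one]
  rfl

lemma norm_charFun_sub_div_abs_le_of_two_pi_lt (hD : D < 1 / 2)
    (hτ : ∀ i, τ i ^ 2 ≤ D * ∑ j, τ j ^ 2) (hτ0 : 0 < ∑ i, τ i ^ 2) (b : ℝ) {s : ℝ}
    (hs : 2 * π < |s|) :
    ‖charFun (chiSqLaw τ) s - charFun (gaussianReal b 1) s‖ / |s| ≤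
      2 * π ^ 2 * (R₂ D * (2 * ∑ i, τ i ^ 2) ^ (-(1 / 2) : ℝ) + R₃) * invSqTail (2 * π) s := by
  have hs0 : 0 < |s| := Real.two_pi_pos.trans hs
  have hinv : |s| ^ (-2 : ℝ) = 1 / |s| / |s| := by
    rw [Real.rpow_neg hs0.le, Real.rpow_two]
    field_simp
  calc ‖charFun (chiSqLaw τ) s - charFun (gaussianReal b 1) s‖ / |s|
      ≤ (2 * π ^ 2 * (R₂ D * (2 * ∑ i, τ i ^ 2) ^ (-(1 / 2) : ℝ)) / |s| +
          Real.exp (-(1 / 2) * |s| ^ 2)) / |s| := by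
        gcongr
        refine (norm_sub_le _ _).trans (add_le_add ?_ ?_)
        · exact norm_charFun_chiSqLaw_le hD hτ hτ0 (abs_pos.1 hs0)
        · rw [norm_charFun_gaussianReal_one, sq_abs]
    _ = 2 * π ^ 2 * (R₂ D * (2 * ∑ i, τ i ^ 2) ^ (-(1 / 2) : ℝ)) * |s| ^ (-2 : ℝ) +
          Real.exp (-(1 / 2) * |s| ^ 2) / |s| := by
        rw [hinv]
        ring
    _ ≤ 2 * π ^ 2 * (R₂ D * (2 * ∑ i, τ i ^ 2) ^ (-(1 / 2) : ℝ)) * |s| ^ (-2 : ℝ) +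
          2 * π ^ 2 * R₃ * |s| ^ (-2 : ℝ) := by
        gcongr
        exact exp_neg_sq_div_le hs
    _ = _ := by
        rw [invSqTail, indicator_of_mem (mem_Ioi.2 hs)]
        ring

lemma R₂_nonneg (D : ℝ) : 0 ≤ R₂ D := by
  unfold R₂
  positivity

lemma R₃_nonneg : 0 ≤ R₃ := by
  unfold R₃
  positivity

lemma Psi_eq (y : ℝ) :
    1 / (2 * π) * (y * Real.exp (2 * π * y) * √(π / (1 / 2))) = Psi y := by
  have hne : √(2 * π) ≠ 0 := by positivity
  rw [Psi, show π / (1 / 2) = 2 * π by ring]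
  nth_rewrite 1 [← Real.mul_self_sqrt Real.two_pi_pos.le]
  field_simp

theorem abs_cdf_chiSqLaw_sub_gaussianReal_le (hD : D < 1 / 2)
    (hτ : ∀ i, τ i ^ 2 ≤ D * ∑ j, τ j ^ 2) (hτ0 : 0 < ∑ i, τ i ^ 2) (b x : ℝ) :
    |(chiSqLaw τ).real (Iic x) - (gaussianReal b 1).real (Iic x)| ≤
      Psi (charFunError τ b) + R₂ D * (2 * ∑ i, τ i ^ 2) ^ (-(1 / 2) : ℝ) + R₃ := by
  set y := charFunError τ b
  set r := R₂ D * (2 * ∑ i, τ i ^ 2) ^ (-(1 / 2) : ℝ)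
  have hy : 0 ≤ y := charFunError_nonneg τ b
  have hr0 : 0 ≤ r := mul_nonneg (R₂_nonneg D) (by positivity)
  set low : ℝ → ℝ := fun s => y * Real.exp (2 * π * y) * Real.exp (-(1 / 2) * s ^ 2)
  set high : ℝ → ℝ := fun s => 2 * π ^ 2 * (r + R₃) * invSqTail (2 * π) s
  have hlow_int : Integrable low := (integrable_exp_neg_mul_sq one_half_pos).const_mul _
  have hhigh_int : Integrable high := (integrable_invSqTail Real.two_pi_pos).const_mul _
  have hbound (s : ℝ) :
      ‖charFun (chiSqLaw τ) s - charFun (gaussianReal b 1) s‖ / |s| ≤ low s + high s := by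
    have hlow0 : 0 ≤ low s := by positivity
    have hhigh0 : 0 ≤ high s :=
      mul_nonneg (mul_nonneg (by positivity) (add_nonneg hr0 R₃_nonneg)) (invSqTail_nonneg _ s)
    rcases le_or_gt |s| (2 * π) with hle | hgt
    · refine le_add_of_le_of_nonneg ?_ hhigh0
      exact div_le_of_le_mul₀ (abs_nonneg s) hlow0
        (norm_charFun_chiSqLaw_sub_gaussianReal_le τ b hle)
    · exact le_add_of_nonneg_of_le hlow0
        (norm_charFun_sub_div_abs_le_of_two_pi_lt hD hτ hτ0 b hgt)
  calc |(chiSqLaw τ).real (Iic x) - (gaussianReal b 1).real (Iic x)|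
      ≤ 1 / (2 * π) * ∫ s, low s + high s :=
        abs_cdf_sub_cdf_le_integral (integrable_id_chiSqLaw τ) IsGaussian.integrable_id
          (hlow_int.add hhigh_int) (fun s _ => hbound s) x
    _ = 1 / (2 * π) * (y * Real.exp (2 * π * y) * √(π / (1 / 2))) + r + R₃ := by
        rw [integral_add hlow_int hhigh_int, integral_const_mul, integral_const_mul,
          integral_gaussian, integral_invSqTail Real.two_pi_pos]
        field_simp
        ring
    _ = Psi y + r + R₃ := by rw [Psi_eq]

end GaussianComparison

section Hermitian

open Matrix

variable {n : ℕ} {M : Matrix (Fin n) (Fin n) ℝ}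

lemma map_eigenvalues_conjTranspose_mul_self (hM : M.IsHermitian) :
    Finset.univ.val.map (isHermitian_conjTranspose_mul_self M).eigenvalues =
      Finset.univ.val.map fun r => hM.eigenvalues r ^ 2 := by
  have hself : IsSelfAdjoint M := hM
  have hcfc : Mᴴ * M = cfc (fun x : ℝ => x ^ 2) M := by rw [cfc_pow_id M 2, hM.eq, sq]
  calc Finset.univ.val.map (isHermitian_conjTranspose_mul_self M).eigenvalues
      = (Mᴴ * M).charpoly.roots :=
        (isHermitian_conjTranspose_mul_self M).roots_charpoly_eq_eigenvalues.symm
    _ = Finset.univ.val.map fun r => hM.eigenvalues r ^ 2 := by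
        rw [hcfc, hM.charpoly_cfc_eq, Polynomial.roots_prod _ _
          (Finset.prod_ne_zero_iff.2 fun _ _ => Polynomial.X_sub_C_ne_zero _)]
        simp only [RCLike.ofReal_real_eq_id, id, Polynomial.roots_X_sub_C,
          Multiset.bind_singleton]

lemma map_singVal (hM : M.IsHermitian) :
    Finset.univ.val.map (singVal M) = Finset.univ.val.map fun r => |hM.eigenvalues r| := by
  have hsqrt := congrArg (Multiset.map (√·)) (map_eigenvalues_conjTranspose_mul_self hM)
  simp only [Multiset.map_map, Function.comp_def, Real.sqrt_sq_eq_abs] at hsqrt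
  exact hsqrt

lemma sum_comp_singVal (hM : M.IsHermitian) (f : ℝ → ℝ) :
    ∑ r, f (singVal M r) = ∑ r, f |hM.eigenvalues r| := by
  have hsum := congrArg (fun s : Multiset ℝ => (s.map f).sum) (map_singVal hM)
  simp only [Multiset.map_map, Function.comp_def] at hsum
  exact hsum

lemma abs_eigenvalues_le_schattenTop (hM : M.IsHermitian) (r : Fin n) :
    |hM.eigenvalues r| ≤ schattenTop M := by
  have hmem : |hM.eigenvalues r| ∈ Finset.univ.val.map (singVal M) := by
    rw [map_singVal hM]
    exact Multiset.mem_map_of_mem _ (Finset.mem_univ_val r)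
  obtain ⟨j, -, hj⟩ := Multiset.mem_map.1 hmem
  rw [← hj]
  exact le_ciSup (finite_range (singVal M)).bddAbove j

lemma schatten_natCast_rpow (hM : M.IsHermitian) (p : ℕ) (q : ℝ) :
    schatten p M ^ q = (∑ r, |hM.eigenvalues r| ^ p) ^ (q / p) := by
  rw [schatten, sum_comp_singVal hM fun x => x ^ (p : ℝ),
    ← Real.rpow_mul (Finset.sum_nonneg fun r _ => by positivity), one_div_mul_eq_div]
  simp only [Real.rpow_natCast]

lemma schatten_two_sq (hM : M.IsHermitian) : schatten 2 M ^ 2 = ∑ r, hM.eigenvalues r ^ 2 := by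
  simpa using schatten_natCast_rpow hM 2 2

lemma schatten_two_pow_three (hM : M.IsHermitian) :
    schatten 2 M ^ 3 = (∑ r, hM.eigenvalues r ^ 2) ^ (3 / 2 : ℝ) := by
  simpa using schatten_natCast_rpow hM 2 3

lemma schatten_three_pow_three (hM : M.IsHermitian) :
    schatten 3 M ^ 3 = ∑ r, |hM.eigenvalues r| ^ 3 := by
  simpa using schatten_natCast_rpow hM 3 3

lemma sum_eigenvalues_sq_pos (hM : M.IsHermitian) (h0 : M ≠ 0) : 0 < ∑ r, hM.eigenvalues r ^ 2 := by
  have hne : hM.eigenvalues ≠ 0 := fun h => h0 (hM.eigenvalues_eq_zero_iff.1 h)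
  obtain ⟨r, hr⟩ := Function.ne_iff.1 hne
  exact Finset.sum_pos' (fun r _ => sq_nonneg _) ⟨r, Finset.mem_univ r, sq_pos_of_ne_zero hr⟩

lemma eigenvalues_sq_le_delta_mul (hM : M.IsHermitian) (h0 : M ≠ 0) (r : Fin n) :
    hM.eigenvalues r ^ 2 ≤ delta M * ∑ j, hM.eigenvalues j ^ 2 := by
  rw [delta, schatten_two_sq hM, div_mul_cancel₀ _ (sum_eigenvalues_sq_pos hM h0).ne', ← sq_abs]
  exact pow_le_pow_left₀ (abs_nonneg _) (abs_eigenvalues_le_schattenTop hM r) 2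

lemma wildBootstrap_eq (M : Matrix (Fin n) (Fin n) ℝ) (e : Fin n → ℝ) :
    wildBootstrap M e = 1 / n * (e ⬝ᵥ M *ᵥ e - M.trace) := by
  have hquad : e ⬝ᵥ M *ᵥ e = ∑ i, ∑ j, M i j * (e i * e j) := by
    simp only [dotProduct, mulVec, Finset.mul_sum]
    exact Finset.sum_congr rfl fun i _ => Finset.sum_congr rfl fun j _ => by ring
  rw [hquad, wildBootstrap]
  simp [mul_sub, Finset.sum_sub_distrib, trace]

lemma dotProduct_mulVec_sum_eigenvectorBasis (hM : M.IsHermitian) (x : Fin n → ℝ)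
    {u : EuclideanSpace ℝ (Fin n)} (hu : u = ∑ r, x r • hM.eigenvectorBasis r) :
    u.ofLp ⬝ᵥ M *ᵥ u.ofLp = ∑ r, hM.eigenvalues r * x r ^ 2 := by
  have hMu : WithLp.toLp 2 (M *ᵥ u.ofLp) =
      ∑ r, (hM.eigenvalues r * x r) • hM.eigenvectorBasis r := by
    rw [hu, WithLp.ofLp_sum, mulVec_sum, WithLp.toLp_sum]
    refine Finset.sum_congr rfl fun r _ => ?_
    rw [WithLp.ofLp_smul, mulVec_smul, hM.mulVec_eigenvectorBasis, smul_smul, mul_comm]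
    rfl
  calc u.ofLp ⬝ᵥ M *ᵥ u.ofLp = inner ℝ (WithLp.toLp 2 (M *ᵥ u.ofLp)) u := by
        rw [EuclideanSpace.inner_eq_star_dotProduct, star_trivial]
    _ = ∑ r, hM.eigenvalues r * x r ^ 2 := by
        rw [hMu, hu, hM.eigenvectorBasis.orthonormal.inner_sum]
        exact Finset.sum_congr rfl fun r _ => by simp; ring

lemma wildBootstrap_sum_eigenvectorBasis (hM : M.IsHermitian) (x : Fin n → ℝ) :
    wildBootstrap M (∑ r, x r • hM.eigenvectorBasis r).ofLp =
      ∑ r, hM.eigenvalues r / n * (x r ^ 2 - 1) := by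
  have htrace : M.trace = ∑ r, hM.eigenvalues r := by simpa using hM.trace_eq_sum_eigenvalues
  rw [wildBootstrap_eq, dotProduct_mulVec_sum_eigenvectorBasis hM x rfl, htrace,
    ← Finset.sum_sub_distrib, Finset.mul_sum]
  exact Finset.sum_congr rfl fun r _ => by ring

lemma map_wildBootstrap (hM : M.IsHermitian) :
    (Measure.pi fun _ : Fin n => gaussianReal 0 1).map (wildBootstrap M) =
      chiSqLaw fun r => hM.eigenvalues r / n := by
  have hmeas : Measurable fun u : EuclideanSpace ℝ (Fin n) => wildBootstrap M u.ofLp := by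
    simp only [wildBootstrap]
    fun_prop
  calc (Measure.pi fun _ : Fin n => gaussianReal 0 1).map (wildBootstrap M)
      = (stdGaussian (EuclideanSpace ℝ (Fin n))).map fun u => wildBootstrap M u.ofLp := by
        rw [← map_pi_eq_stdGaussian, Measure.map_map hmeas (by fun_prop)]
        rfl
    _ = chiSqLaw fun r => hM.eigenvalues r / n := by
        rw [stdGaussian_eq_map_pi_orthonormalBasis hM.eigenvectorBasis,
          Measure.map_map hmeas (by fun_prop), chiSqLaw]
        congr 1 with x
        exact wildBootstrap_sum_eigenvectorBasis hM x

end Hermitian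

section LyapunovRatio

variable {ι : Type*} [Fintype ι]

/-- The Lyapunov ratio of the weights `τ`, which controls the error of the normal approximation of
`chiSqLaw τ`; for the eigenvalues of a symmetric matrix it is `‖M‖₃³ / ‖M‖₂³`. -/
def lyapunovRatio (τ : ι → ℝ) : ℝ := (∑ i, |τ i| ^ 3) / (∑ i, τ i ^ 2) ^ (3 / 2 : ℝ)

lemma lyapunovRatio_const_mul {c : ℝ} (hc : c ≠ 0) (τ : ι → ℝ) :
    lyapunovRatio (fun i => c * τ i) = lyapunovRatio τ := by
  have hpow : (c ^ 2) ^ (3 / 2 : ℝ) = |c| ^ 3 := by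
    rw [← sq_abs, ← Real.rpow_natCast, ← Real.rpow_mul (abs_nonneg c), ← Real.rpow_natCast]
    norm_num
  simp only [lyapunovRatio, abs_mul, mul_pow, ← Finset.mul_sum]
  rw [Real.mul_rpow (sq_nonneg c) (by positivity), hpow, mul_div_mul_left _ _ (by positivity)]

lemma two_mul_rpow_three_halves {S : ℝ} (hS : 0 ≤ S) :
    (2 * S) ^ (3 / 2 : ℝ) = 2 * √2 * S ^ (3 / 2 : ℝ) := by
  rw [Real.mul_rpow two_pos.le hS, show (3 / 2 : ℝ) = 1 + 1 / 2 by norm_num,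
    Real.rpow_add two_pos, Real.rpow_one, ← Real.sqrt_eq_rpow]

lemma lyapunovRatio_mul_rpow {τ : ι → ℝ} (hτ0 : 0 < ∑ i, τ i ^ 2) :
    lyapunovRatio τ * (2 * ∑ i, τ i ^ 2) ^ (3 / 2 : ℝ) = 2 * √2 * ∑ i, |τ i| ^ 3 := by
  rw [lyapunovRatio, two_mul_rpow_three_halves hτ0.le]
  field_simp

lemma skewness_chiSqLaw_of_nonneg {τ : ι → ℝ} (hτ : ∀ i, 0 ≤ τ i) :
    skewness (chiSqLaw τ) = 2 * √2 * lyapunovRatio τ := by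
  have hsqrt : √2 * √2 = (2 : ℝ) := Real.mul_self_sqrt two_pos.le
  rw [skewness_chiSqLaw, lyapunovRatio, two_mul_rpow_three_halves (by positivity)]
  simp only [abs_of_nonneg (hτ _)]
  rw [← div_div, ← mul_div_assoc]
  congr 1
  field_simp
  linear_combination -4 * (∑ i, τ i ^ 3) * hsqrt

lemma R₁_eq {n : ℕ} {M : Matrix (Fin n) (Fin n) ℝ} (hM : M.IsHermitian) :
    R₁ M = 4 / 3 * √2 * π ^ 2 * lyapunovRatio hM.eigenvalues := by
  rw [R₁, lyapunovRatio, schatten_two_pow_three hM, schatten_three_pow_three hM, mul_div_assoc]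

end LyapunovRatio

section KolmogorovDistance

lemma map_const_mul_real_Iic (μ : Measure ℝ) {c : ℝ} (hc : 0 < c) (x : ℝ) :
    (μ.map fun y => c * y).real (Iic x) = μ.real (Iic (x / c)) := by
  rw [map_measureReal_apply (by fun_prop) measurableSet_Iic]
  congr 1 with y
  simp [le_div_iff₀ hc, mul_comm]

lemma kolmogorovDist_map_const_mul (μ ν : Measure ℝ) {c : ℝ} (hc : 0 < c) :
    kolmogorovDist (μ.map fun y => c * y) (ν.map fun y => c * y) = kolmogorovDist μ ν := by
  simp only [kolmogorovDist, map_const_mul_real_Iic _ hc]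
  exact (Equiv.divRight₀ c hc.ne').iSup_comp
    (g := fun x => |μ.real (Iic x) - ν.real (Iic x)|)

theorem kolmogorovDist_chiSqLaw_gaussianReal_le {ι : Type*} [Fintype ι] {τ : ι → ℝ} {D : ℝ}
    (hD : D < 1 / 2) (hτ : ∀ i, τ i ^ 2 ≤ D * ∑ j, τ j ^ 2) (hτ0 : 0 < ∑ i, τ i ^ 2) (m : ℝ)
    {v : NNReal} (hv : 0 < v) :
    kolmogorovDist (chiSqLaw τ) (gaussianReal m v) ≤
      Psi (4 / 3 * √2 * π ^ 2 * lyapunovRatio τ * (Var[id; chiSqLaw τ] / v) ^ (3 / 2 : ℝ) +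
          |m| / √v + π * |Var[id; chiSqLaw τ] / v - 1|) +
        R₂ D * (Var[id; chiSqLaw τ] / v) ^ (-(1 / 2) : ℝ) + R₃ := by
  set c : ℝ := (√v)⁻¹ with hc
  have hc0 : 0 < c := by positivity
  have hc2 : c ^ 2 * v = 1 := by
    rw [hc, inv_pow, Real.sq_sqrt v.coe_nonneg, inv_mul_cancel₀ (by positivity)]
  have hsum : ∑ i, (c * τ i) ^ 2 = c ^ 2 * ∑ i, τ i ^ 2 := by simp only [mul_pow, Finset.mul_sum]
  have hsum0 : 0 < ∑ i, (c * τ i) ^ 2 := hsum ▸ by positivity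
  have hmax (i : ι) : (c * τ i) ^ 2 ≤ D * ∑ j, (c * τ j) ^ 2 := by
    rw [hsum, mul_pow, mul_left_comm]
    gcongr
    exact hτ i
  have hvar : Var[id; chiSqLaw τ] / v = 2 * ∑ i, (c * τ i) ^ 2 := by
    rw [variance_chiSqLaw, hsum, div_eq_iff (by positivity)]
    linear_combination -2 * (∑ i, τ i ^ 2) * hc2
  have hgauss : (gaussianReal m v).map (fun y => c * y) = gaussianReal (c * m) 1 := by
    rw [gaussianReal_map_const_mul]
    congr 1
    exact NNReal.eq hc2
  have herror : charFunError (fun i => c * τ i) (c * m) =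
      4 / 3 * √2 * π ^ 2 * lyapunovRatio τ * (2 * ∑ i, (c * τ i) ^ 2) ^ (3 / 2 : ℝ) +
        |m| / √v + π * |2 * ∑ i, (c * τ i) ^ 2 - 1| := by
    have hsqrt : √2 * √2 = (2 : ℝ) := Real.mul_self_sqrt two_pos.le
    rw [← lyapunovRatio_const_mul hc0.ne' τ, mul_assoc _ (lyapunovRatio _),
      lyapunovRatio_mul_rpow hsum0, charFunError, abs_mul, abs_of_pos hc0, hc]
    linear_combination -8 / 3 * π ^ 2 * (∑ i, |(√v)⁻¹ * τ i| ^ 3) * hsqrt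
  rw [← kolmogorovDist_map_const_mul _ _ hc0, map_const_mul_chiSqLaw, hgauss, hvar, ← herror]
  exact ciSup_le fun x => abs_cdf_chiSqLaw_sub_gaussianReal_le hD hmax hsum0 (c * m) x

end KolmogorovDistance

section WildBootstrap

variable {n : ℕ} {M : Matrix (Fin n) (Fin n) ℝ}

lemma natCast_pos_of_matrix_ne_zero (h0 : M ≠ 0) : (0 : ℝ) < n := by
  rcases Nat.eq_zero_or_pos n with rfl | hn
  · exact absurd (Subsingleton.elim M 0) h0
  · exact_mod_cast hn

lemma lyapunovRatio_eigenvalues_div (hM : M.IsHermitian) (h0 : M ≠ 0) :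
    lyapunovRatio (fun r => hM.eigenvalues r / n) = lyapunovRatio hM.eigenvalues := by
  simp only [div_eq_inv_mul]
  exact lyapunovRatio_const_mul (inv_pos.2 (natCast_pos_of_matrix_ne_zero h0)).ne' _

theorem R₁_eq_skewness_map_wildBootstrap (hM : M.PosSemidef) (h0 : M ≠ 0) :
    R₁ M = 2 * π ^ 2 / 3 *
      skewness ((Measure.pi fun _ : Fin n => gaussianReal 0 1).map (wildBootstrap M)) := by
  rw [map_wildBootstrap hM.isHermitian, skewness_chiSqLaw_of_nonneg fun r =>
    div_nonneg (hM.eigenvalues_nonneg r) n.cast_nonneg, lyapunovRatio_eigenvalues_div _ h0,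
    R₁_eq hM.isHermitian]
  ring

theorem kolmogorovDist_map_wildBootstrap_le (hM : M.IsHermitian) (h0 : M ≠ 0)
    (hδ : delta M < 1 / 2) {m v : ℝ} (hm : 0 ≤ m) (hv : 0 < v) {μ : Measure ℝ}
    (hμ : μ = (Measure.pi fun _ : Fin n => gaussianReal 0 1).map (wildBootstrap M)) :
    kolmogorovDist μ ((gaussianReal m v.toNNReal).map fun z => n * z) ≤
      Psi (R₁ M * varMismatch n μ v ^ (3 / 2 : ℝ) + meanShift m v
          + π * |varMismatch n μ v - 1|)
        + R₂ (delta M) * varMismatch n μ v ^ (-(1 / 2) : ℝ) + R₃ := by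
  have hn := natCast_pos_of_matrix_ne_zero h0
  set τ : Fin n → ℝ := fun r => hM.eigenvalues r / n with hτ
  have hsum : ∑ r, τ r ^ 2 = (∑ r, hM.eigenvalues r ^ 2) / n ^ 2 := by
    simp only [hτ, div_pow, Finset.sum_div]
  have hsum0 : 0 < ∑ r, τ r ^ 2 := hsum ▸ div_pos (sum_eigenvalues_sq_pos hM h0) (by positivity)
  have hmax (r : Fin n) : τ r ^ 2 ≤ delta M * ∑ j, τ j ^ 2 := by
    rw [hsum, hτ, div_pow, ← mul_div_assoc]
    gcongr
    exact eigenvalues_sq_le_delta_mul hM h0 r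
  set w : NNReal := ⟨(n : ℝ) ^ 2, sq_nonneg _⟩ * v.toNNReal
  have hw : (w : ℝ) = n ^ 2 * v := congrArg ((n : ℝ) ^ 2 * ·) (Real.coe_toNNReal v hv.le)
  have hw0 : 0 < w := by
    rw [← NNReal.coe_pos, hw]
    positivity
  have hshift : |n * m| / √w = meanShift m v := by
    rw [hw, Real.sqrt_mul (sq_nonneg _), Real.sqrt_sq hn.le, abs_of_nonneg (by positivity),
      mul_div_mul_left _ _ hn.ne', meanShift]
  have hbound := kolmogorovDist_chiSqLaw_gaussianReal_le hδ hmax hsum0 (n * m) hw0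
  rw [lyapunovRatio_eigenvalues_div hM h0, ← R₁_eq, hshift, hw] at hbound
  rwa [gaussianReal_map_const_mul, varMismatch, hμ, map_wildBootstrap hM]

end WildBootstrap

section CondDistrib

variable {Ω β γ δ : Type*} [MeasurableSpace Ω] [MeasurableSpace β] [MeasurableSpace γ]
  [MeasurableSpace δ]

lemma map_prodMk_of_indepFun {ρ : Measure Ω} [IsFiniteMeasure ρ] {X : Ω → β} {E : Ω → γ}
    (hX : AEMeasurable X ρ) (hE : AEMeasurable E ρ) (hXE : IndepFun X E ρ) {F : β × γ → δ}
    (hF : Measurable F) :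
    ρ.map (fun ω => (X ω, F (X ω, E ω))) =
      ρ.map X ⊗ₘ (Kernel.id ×ₖ Kernel.const β (ρ.map E)).map F := by
  have hG : Measurable fun p : β × γ => (p.1, F p) := by fun_prop
  calc ρ.map (fun ω => (X ω, F (X ω, E ω)))
      = ((ρ.map X).prod (ρ.map E)).map fun p => (p.1, F p) := by
        rw [← (indepFun_iff_map_prod_eq_prod_map_map hX hE).1 hXE,
          AEMeasurable.map_map_of_aemeasurable hG.aemeasurable (hX.prodMk hE)]
        rfl
    _ = ρ.map X ⊗ₘ (Kernel.id ×ₖ Kernel.const β (ρ.map E)).map F := by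
        ext s hs
        have hslice (x : β) : Measurable fun y : δ => (x, y) := by fun_prop
        rw [Measure.map_apply hG hs, Measure.prod_apply (hG hs), Measure.compProd_apply hs]
        refine lintegral_congr fun x => ?_
        rw [Kernel.map_apply' _ hF _ (hslice x hs), Kernel.prod_apply, Kernel.id_apply,
          Kernel.const_apply, Measure.dirac_prod,
          Measure.map_apply (by fun_prop) (hF (hslice x hs))]
        rfl

theorem condDistrib_comp_of_indepFun [StandardBorelSpace δ] [Nonempty δ] {ρ : Measure Ω}
    [IsFiniteMeasure ρ] {X : Ω → β} {E : Ω → γ} (hX : AEMeasurable X ρ) (hE : AEMeasurable E ρ)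
    (hXE : IndepFun X E ρ) {F : β × γ → δ} (hF : Measurable F) :
    ∀ᵐ x ∂ρ.map X, condDistrib (fun ω => F (X ω, E ω)) X ρ x =
      (ρ.map E).map fun e => F (x, e) := by
  filter_upwards [condDistrib_ae_eq_of_measure_eq_compProd X
    (hF.comp_aemeasurable (hX.prodMk hE)) (map_prodMk_of_indepFun hX hE hXE hF)] with x hx
  refine hx.trans ?_
  rw [Kernel.map_apply _ hF, Kernel.prod_apply, Kernel.id_apply, Kernel.const_apply,
    Measure.dirac_prod, Measure.map_map hF (by fun_prop)]
  rfl

end CondDistrib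

section PositiveDefiniteKernel

variable {𝒳 E : Type*} [MeasurableSpace 𝒳] [NormedAddCommGroup E] [InnerProductSpace ℝ E]
  {P : Measure 𝒳} {Φ : 𝒳 → E}

lemma integral_inner_self_nonneg_of_integrable [SFinite P] (hΦ : Integrable Φ P) :
    0 ≤ ∫ z : 𝒳 × 𝒳, inner ℝ (Φ z.1) (Φ z.2) ∂P.prod P := by
  set Φ' : 𝒳 → UniformSpace.Completion E := fun x => Φ x
  have hΦ' : Integrable Φ' P := (UniformSpace.Completion.toComplL (𝕜 := ℝ)).integrable_comp hΦ
  calc (0 : ℝ) ≤ inner ℝ (∫ x, Φ' x ∂P) (∫ x, Φ' x ∂P) := real_inner_self_nonneg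
    _ = ∫ z : 𝒳 × 𝒳, inner ℝ (Φ' z.1) (Φ' z.2) ∂P.prod P :=
        (integral_prod_bilin (innerSL ℝ) hΦ' hΦ').symm
    _ = ∫ z : 𝒳 × 𝒳, inner ℝ (Φ z.1) (Φ z.2) ∂P.prod P := by
        simp only [Φ', UniformSpace.Completion.inner_coe]

/- `Φ` itself need not be integrable, so the integral is exhausted by the sets `s N ×ˢ s N` on
which it is bounded. -/
theorem integral_inner_self_nonneg [IsFiniteMeasure P] (hΦ : StronglyMeasurable Φ)
    (hint : Integrable (fun z : 𝒳 × 𝒳 => inner ℝ (Φ z.1) (Φ z.2)) (P.prod P)) :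
    0 ≤ ∫ z : 𝒳 × 𝒳, inner ℝ (Φ z.1) (Φ z.2) ∂P.prod P := by
  set s : ℕ → Set 𝒳 := fun N => {x | ‖Φ x‖ ≤ N}
  have hs (N : ℕ) : MeasurableSet (s N) := measurableSet_le hΦ.norm.measurable measurable_const
  have hmono : Monotone s := fun N N' hN x (hx : ‖Φ x‖ ≤ N) =>
    hx.trans (Nat.cast_le.2 hN)
  have hunion : ⋃ N, s N ×ˢ s N = univ := by
    have hcover : ⋃ N, s N = univ := iUnion_eq_univ_iff.2 fun x => exists_nat_ge ‖Φ x‖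
    rw [iUnion_prod_of_monotone hmono hmono, hcover, univ_prod_univ]
  have hlim := tendsto_setIntegral_of_monotone (fun N => (hs N).prod (hs N))
    (fun N N' hN => prod_mono (hmono hN) (hmono hN)) hint.integrableOn
  rw [hunion, setIntegral_univ] at hlim
  refine ge_of_tendsto' hlim fun N => ?_
  rw [← Measure.prod_restrict]
  refine integral_inner_self_nonneg_of_integrable
    (.of_bound hΦ.aestronglyMeasurable N ?_)
  exact (ae_restrict_iff' (hs N)).2 (.of_forall fun x hx => hx)

end PositiveDefiniteKernel

section ResidualKernel

open scoped TensorProduct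

variable {𝒜 ℬ 𝒞 HA HB HC : Type*}
  [NormedAddCommGroup HA] [InnerProductSpace ℝ HA]
  [NormedAddCommGroup HB] [InnerProductSpace ℝ HB]
  [NormedAddCommGroup HC] [InnerProductSpace ℝ HC]
  (φA : 𝒜 → HA) (φB : ℬ → HB) (φC : 𝒞 → HC) (muA : 𝒞 → HA) (muB : 𝒞 → HB)

/-- The feature map of the kernel `hHat`, with values in the (uncompleted) tensor product of the
three feature spaces. -/
def hHatFeature (x : 𝒜 × ℬ × 𝒞) : HC ⊗[ℝ] (HA ⊗[ℝ] HB) :=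
  φC x.2.2 ⊗ₜ[ℝ] ((φA x.1 - muA x.2.2) ⊗ₜ[ℝ] (φB x.2.1 - muB x.2.2))

lemma hHat_eq_inner (x x' : 𝒜 × ℬ × 𝒞) : hHat φA φB φC muA muB x x' =
    inner ℝ (hHatFeature φA φB φC muA muB x) (hHatFeature φA φB φC muA muB x') := by
  simp [hHat, hHatFeature, mul_assoc]

theorem posSemidef_gram_hHat {n : ℕ} (x : Fin n → 𝒜 × ℬ × 𝒞) :
    (gram (hHat φA φB φC muA muB) x).PosSemidef := by
  have hgram : gram (hHat φA φB φC muA muB) x =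
      Matrix.gram ℝ fun i => hHatFeature φA φB φC muA muB (x i) := by
    ext i j
    exact hHat_eq_inner φA φB φC muA muB (x i) (x j)
  rw [hgram]
  exact Matrix.posSemidef_gram ℝ fun i => hHatFeature φA φB φC muA muB (x i)

variable [MeasurableSpace 𝒜] [MeasurableSpace ℬ] [MeasurableSpace 𝒞] {φA φB φC muA muB}

lemma stronglyMeasurable_hHatFeature (hφA : StronglyMeasurable φA) (hφB : StronglyMeasurable φB)
    (hφC : StronglyMeasurable φC) (hmuA : StronglyMeasurable muA)
    (hmuB : StronglyMeasurable muB) :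
    StronglyMeasurable (hHatFeature φA φB φC muA muB) := by
  have hc : Measurable fun x : 𝒜 × ℬ × 𝒞 => x.2.2 := by fun_prop
  have hA := (hφA.comp_measurable measurable_fst).sub (hmuA.comp_measurable hc)
  have hB := (hφB.comp_measurable (measurable_fst.comp measurable_snd)).sub
    (hmuB.comp_measurable hc)
  exact TensorProduct.continuous_tmul.comp_stronglyMeasurable ((hφC.comp_measurable hc).prodMk
    (TensorProduct.continuous_tmul.comp_stronglyMeasurable (hA.prodMk hB)))

theorem measurable_uncurry_hHat (hφA : StronglyMeasurable φA) (hφB : StronglyMeasurable φB)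
    (hφC : StronglyMeasurable φC) (hmuA : StronglyMeasurable muA)
    (hmuB : StronglyMeasurable muB) :
    Measurable (Function.uncurry (hHat φA φB φC muA muB)) := by
  have hfeature := stronglyMeasurable_hHatFeature hφA hφB hφC hmuA hmuB
  simp only [Function.uncurry_def, hHat_eq_inner]
  exact ((hfeature.comp_measurable measurable_fst).inner (𝕜 := ℝ)
    (hfeature.comp_measurable measurable_snd)).measurable

theorem population_hHat_nonneg (hφA : StronglyMeasurable φA) (hφB : StronglyMeasurable φB)
    (hφC : StronglyMeasurable φC) (hmuA : StronglyMeasurable muA)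
    (hmuB : StronglyMeasurable muB) {P : Measure (𝒜 × ℬ × 𝒞)} [IsFiniteMeasure P]
    (hint : Integrable (Function.uncurry (hHat φA φB φC muA muB)) (P.prod P)) :
    0 ≤ population (hHat φA φB φC muA muB) P := by
  simp only [Function.uncurry_def, population, hHat_eq_inner] at hint ⊢
  exact integral_inner_self_nonneg (stronglyMeasurable_hHatFeature hφA hφB hφC hmuA hmuB) hint

end ResidualKernel

section KernelMatrix

variable {𝒳 : Type*} {h : 𝒳 → 𝒳 → ℝ} {n : ℕ}

lemma isHermitian_gramOff {x : Fin n → 𝒳} (hx : (gram h x).IsHermitian) :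
    (gramOff h x).IsHermitian := by
  refine Matrix.IsHermitian.ext fun i j => ?_
  have hij : h (x j) (x i) = h (x i) (x j) := hx.apply i j
  simp only [gramOff, Matrix.of_apply, star_trivial, ne_comm (a := j), hij]

lemma wildBootstrapOff_gramOff (x : Fin n → 𝒳) (e : Fin n → ℝ) :
    wildBootstrapOff (gramOff h x) e = wildBootstrap (gramOff h x) e := by
  simp only [wildBootstrapOff, wildBootstrap, gramOff, Matrix.of_apply]
  congr 1
  refine Finset.sum_congr rfl fun i _ => Finset.sum_congr rfl fun j _ => ?_
  by_cases hij : i = j <;> simp [hij, mul_assoc]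

variable [MeasurableSpace 𝒳]

lemma measurable_kernel_eval (hh : Measurable (Function.uncurry h)) (i j : Fin n) :
    Measurable fun x : Fin n → 𝒳 => h (x i) (x j) := by
  have hpair : Measurable fun x : Fin n → 𝒳 => (x i, x j) := by fun_prop
  exact hh.comp hpair

lemma measurable_gram (hh : Measurable (Function.uncurry h)) :
    Measurable fun (x : Fin n → 𝒳) i j => gram h x i j :=
  measurable_pi_lambda _ fun i => measurable_pi_lambda _ fun j => measurable_kernel_eval hh i j

lemma measurable_gramOff (hh : Measurable (Function.uncurry h)) :
    Measurable fun (x : Fin n → 𝒳) i j => gramOff h x i j := by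
  refine measurable_pi_lambda _ fun i => measurable_pi_lambda _ fun j => ?_
  simp only [gramOff, Matrix.of_apply]
  exact .ite (.const _) (measurable_kernel_eval hh i j) measurable_const

lemma measurable_wildBootstrap_of : Measurable fun p : (Fin n → Fin n → ℝ) × (Fin n → ℝ) =>
    wildBootstrap (Matrix.of p.1) p.2 := by
  simp only [wildBootstrap, Matrix.of_apply]
  fun_prop

lemma map_eq_pi_gaussianReal {Ω : Type*} [MeasurableSpace Ω] {ρ : Measure Ω}
    {ε : Fin n → Ω → ℝ} (hε : ∀ i, HasLaw (ε i) (gaussianReal 0 1) ρ) (hεindep : iIndepFun ε ρ) :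
    ρ.map (fun ω i => ε i ω) = Measure.pi fun _ : Fin n => gaussianReal 0 1 := by
  have : IsProbabilityMeasure ρ := hεindep.isProbabilityMeasure
  rw [(iIndepFun_iff_map_fun_eq_pi_map fun i => (hε i).aemeasurable).1 hεindep]
  simp only [(hε _).map_eq]

theorem condLaw_wildBootstrap {Ω : Type*} [MeasurableSpace Ω] {ρ : Measure Ω} [IsFiniteMeasure ρ]
    {X : Ω → 𝒳} (hX : AEMeasurable X ρ) {ε : Fin n → Ω → ℝ}
    (hε : ∀ i, HasLaw (ε i) (gaussianReal 0 1) ρ) (hεindep : iIndepFun ε ρ)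
    (hXε : IndepFun X (fun ω i => ε i ω) ρ) {G : 𝒳 → Matrix (Fin n) (Fin n) ℝ}
    (hG : Measurable fun x i j => G x i j) :
    ∀ᵐ ω ∂ρ, condLaw (fun ω => wildBootstrap (G (X ω)) fun i => ε i ω) (fun ω => G (X ω)) ρ ω =
      (Measure.pi fun _ : Fin n => gaussianReal 0 1).map (wildBootstrap (G (X ω))) := by
  have hεm : AEMeasurable (fun ω i => ε i ω) ρ :=
    aemeasurable_pi_lambda _ fun i => (hε i).aemeasurable
  have hGX : AEMeasurable (fun ω i j => G (X ω) i j) ρ := hG.comp_aemeasurable hX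
  rw [← map_eq_pi_gaussianReal hε hεindep]
  exact ae_of_ae_map hGX (condDistrib_comp_of_indepFun hGX hεm (hXε.comp hG measurable_id)
    measurable_wildBootstrap_of)

end KernelMatrix

end

end KCI

theorem mainTheorem4_general
    {𝒳 Ω Ω' : Type*} [MeasurableSpace 𝒳] [MeasurableSpace Ω] [MeasurableSpace Ω']
    {n : ℕ} {h : 𝒳 → 𝒳 → ℝ} (hh : Measurable (Function.uncurry h))
    (hpsd : ∀ x : Fin n → 𝒳, (KCI.gram h x).PosSemidef)
    {ρ : Measure Ω} [IsFiniteMeasure ρ]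
    {X : Fin n → Ω → 𝒳} (hX : ∀ i, AEMeasurable (X i) ρ)
    {ε : Fin n → Ω → ℝ} (hε : ∀ i, HasLaw (ε i) (gaussianReal 0 1) ρ) (hεindep : iIndepFun ε ρ)
    (hXε : IndepFun (fun ω i => X i ω) (fun ω i => ε i ω) ρ)
    {m v : ℝ} (hm : 0 ≤ m) (hv : 0 < v)
    {ρ' : Measure Ω'} {Z : Ω' → ℝ} (hZ : HasLaw Z (gaussianReal m v.toNNReal) ρ')
    {H Hoff : Ω → Matrix (Fin n) (Fin n) ℝ}
    (hH : ∀ ω, H ω = KCI.gram h (fun i => X i ω))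
    (hHoff : ∀ ω, Hoff ω = KCI.gramOff h (fun i => X i ω))
    {Y Yoff : Ω → ℝ}
    (hY : ∀ ω, Y ω = KCI.wildBootstrap (H ω) (fun i => ε i ω))
    (hYoff : ∀ ω, Yoff ω = KCI.wildBootstrapOff (Hoff ω) (fun i => ε i ω)) :
    (∀ᵐ ω ∂ρ, H ω ≠ 0 → KCI.delta (H ω) < 1 / 2 →
      KCI.R₁ (H ω) = 2 * Real.pi ^ 2 / 3 * KCI.skewness (KCI.condLaw Y H ρ ω) ∧
      KCI.kolmogorovDist (KCI.condLaw Y H ρ ω) (ρ'.map fun ω' => n * Z ω') ≤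
        KCI.Psi (KCI.R₁ (H ω) * KCI.varMismatch n (KCI.condLaw Y H ρ ω) v ^ (3 / 2 : ℝ)
            + KCI.meanShift m v
            + Real.pi * |KCI.varMismatch n (KCI.condLaw Y H ρ ω) v - 1|)
          + KCI.R₂ (KCI.delta (H ω)) * KCI.varMismatch n (KCI.condLaw Y H ρ ω) v ^ (-(1 / 2) : ℝ)
          + KCI.R₃) ∧
    (∀ᵐ ω ∂ρ, Hoff ω ≠ 0 → KCI.delta (Hoff ω) < 1 / 2 →
      KCI.kolmogorovDist (KCI.condLaw Yoff Hoff ρ ω) (ρ'.map fun ω' => n * Z ω') ≤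
        KCI.Psi (KCI.R₁ (Hoff ω) * KCI.varMismatch n (KCI.condLaw Yoff Hoff ρ ω) v ^ (3 / 2 : ℝ)
            + KCI.meanShift m v
            + Real.pi * |KCI.varMismatch n (KCI.condLaw Yoff Hoff ρ ω) v - 1|)
          + KCI.R₂ (KCI.delta (Hoff ω))
            * KCI.varMismatch n (KCI.condLaw Yoff Hoff ρ ω) v ^ (-(1 / 2) : ℝ)
          + KCI.R₃) := by
  obtain rfl : H = fun ω => KCI.gram h fun i => X i ω := funext hH
  obtain rfl : Hoff = fun ω => KCI.gramOff h fun i => X i ω := funext hHoff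
  obtain rfl : Y = fun ω => KCI.wildBootstrap (KCI.gram h fun i => X i ω) fun i => ε i ω :=
    funext hY
  obtain rfl : Yoff = fun ω => KCI.wildBootstrap (KCI.gramOff h fun i => X i ω) fun i => ε i ω :=
    funext fun ω => (hYoff ω).trans (KCI.wildBootstrapOff_gramOff _ _)
  have hXm : AEMeasurable (fun ω i => X i ω) ρ := aemeasurable_pi_lambda _ hX
  have hnZ : (ρ'.map fun ω' => n * Z ω') = (gaussianReal m v.toNNReal).map fun z : ℝ => n * z := by
    rw [← hZ.map_eq, AEMeasurable.map_map_of_aemeasurable (by fun_prop) hZ.aemeasurable]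
    rfl
  rw [hnZ]
  constructor
  · filter_upwards [KCI.condLaw_wildBootstrap hXm hε hεindep hXε (KCI.measurable_gram hh)]
      with ω hω h0 hδ
    exact ⟨hω ▸ KCI.R₁_eq_skewness_map_wildBootstrap (hpsd _) h0,
      KCI.kolmogorovDist_map_wildBootstrap_le (hpsd _).isHermitian h0 hδ hm hv hω⟩
  · filter_upwards [KCI.condLaw_wildBootstrap hXm hε hεindep hXε (KCI.measurable_gramOff hh)]
      with ω hω h0 hδ
    exact KCI.kolmogorovDist_map_wildBootstrap_le
      (KCI.isHermitian_gramOff (hpsd _).isHermitian) h0 hδ hm hv hω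

theorem mainTheorem4
    {𝒜 ℬ 𝒞 HA HB HC Ω Ω' : Type*}
    [MeasurableSpace 𝒜] [MeasurableSpace ℬ] [MeasurableSpace 𝒞]
    [NormedAddCommGroup HA] [InnerProductSpace ℝ HA] [CompleteSpace HA]
    [NormedAddCommGroup HB] [InnerProductSpace ℝ HB] [CompleteSpace HB]
    [NormedAddCommGroup HC] [InnerProductSpace ℝ HC] [CompleteSpace HC]
    [MeasurableSpace Ω] [MeasurableSpace Ω']
    -- feature maps of the three kernels and the estimated conditional mean embeddings
    (φA : 𝒜 → HA) (φB : ℬ → HB) (φC : 𝒞 → HC) (muA : 𝒞 → HA) (muB : 𝒞 → HB)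
    (hφA : StronglyMeasurable φA) (hφB : StronglyMeasurable φB) (hφC : StronglyMeasurable φC)
    (hmuA : StronglyMeasurable muA) (hmuB : StronglyMeasurable muB)
    -- the law of `(A, B, C)`, under the null
    (P : Measure (𝒜 × ℬ × 𝒞)) [IsProbabilityMeasure P]
    (hnull : KCI.CondIndepGiven P)
    (h : 𝒜 × ℬ × 𝒞 → 𝒜 × ℬ × 𝒞 → ℝ) (hh : h = KCI.hHat φA φB φC muA muB)
    (hL2 : MemLp (fun z => h z.1 z.2) 2 (P.prod P))
    -- the test sample and the Gaussian multipliers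
    (ρ : Measure Ω) [IsProbabilityMeasure ρ] (n : ℕ)
    (X : Fin n → Ω → 𝒜 × ℬ × 𝒞) (hX : ∀ i, HasLaw (X i) P ρ) (hXindep : iIndepFun X ρ)
    (ε : Fin n → Ω → ℝ) (hε : ∀ i, HasLaw (ε i) (gaussianReal 0 1) ρ) (hεindep : iIndepFun ε ρ)
    (hXε : IndepFun (fun ω i => X i ω) (fun ω i => ε i ω) ρ)
    -- mean and variance of the statistic
    (m v : ℝ) (hm : m = KCI.population h P)
    (hv : v = Var[fun ω => KCI.uStat h (fun i => X i ω); ρ]) (hvpos : 0 < v)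
    -- the moment-matched normal variable
    (ρ' : Measure Ω') [IsProbabilityMeasure ρ']
    (Z : Ω' → ℝ) (hZ : HasLaw Z (gaussianReal m v.toNNReal) ρ')
    -- the full kernel matrix with the centered quadratic form,
    -- and the off-diagonal kernel matrix with the off-diagonal sum
    (H Hoff : Ω → Matrix (Fin n) (Fin n) ℝ)
    (hH : ∀ ω, H ω = KCI.gram h (fun i => X i ω))
    (hHoff : ∀ ω, Hoff ω = KCI.gramOff h (fun i => X i ω))
    (Y Yoff : Ω → ℝ)
    (hY : ∀ ω, Y ω = KCI.wildBootstrap (H ω) (fun i => ε i ω))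
    (hYoff : ∀ ω, Yoff ω = KCI.wildBootstrapOff (Hoff ω) (fun i => ε i ω)) :
    (∀ᵐ ω ∂ρ, H ω ≠ 0 → KCI.delta (H ω) < 1 / 2 →
      KCI.R₁ (H ω) = 2 * Real.pi ^ 2 / 3 * KCI.skewness (KCI.condLaw Y H ρ ω) ∧
      KCI.kolmogorovDist (KCI.condLaw Y H ρ ω) (ρ'.map fun ω' => n * Z ω') ≤
        KCI.Psi (KCI.R₁ (H ω) * KCI.varMismatch n (KCI.condLaw Y H ρ ω) v ^ (3 / 2 : ℝ)
            + KCI.meanShift m v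
            + Real.pi * |KCI.varMismatch n (KCI.condLaw Y H ρ ω) v - 1|)
          + KCI.R₂ (KCI.delta (H ω)) * KCI.varMismatch n (KCI.condLaw Y H ρ ω) v ^ (-(1 / 2) : ℝ)
          + KCI.R₃) ∧
    (∀ᵐ ω ∂ρ, Hoff ω ≠ 0 → KCI.delta (Hoff ω) < 1 / 2 →
      KCI.kolmogorovDist (KCI.condLaw Yoff Hoff ρ ω) (ρ'.map fun ω' => n * Z ω') ≤
        KCI.Psi (KCI.R₁ (Hoff ω) * KCI.varMismatch n (KCI.condLaw Yoff Hoff ρ ω) v ^ (3 / 2 : ℝ)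
            + KCI.meanShift m v
            + Real.pi * |KCI.varMismatch n (KCI.condLaw Yoff Hoff ρ ω) v - 1|)
          + KCI.R₂ (KCI.delta (Hoff ω))
            * KCI.varMismatch n (KCI.condLaw Yoff Hoff ρ ω) v ^ (-(1 / 2) : ℝ)
          + KCI.R₃) := by
  subst hh hm
  exact mainTheorem4_general (KCI.measurable_uncurry_hHat hφA hφB hφC hmuA hmuB)
    (KCI.posSemidef_gram_hHat φA φB φC muA muB) (fun i => (hX i).aemeasurable) hε hεindep hXε
    (KCI.population_hHat_nonneg hφA hφB hφC hmuA hmuB (hL2.integrable one_le_two)) hvpos hZ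
    hH hHoff hY hYoff
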